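/- Let $V$ be a countable set and let $G=(V,E,m)$ be a weighted graph: $E:V\times V\to[0,\infty)$ is symmetric, $m:V\to(0,\infty)$, every $x\in V$ has only finitely many neighbors (vertices $y$ with $E(x,y)>0$), and every connected component is infinite. For $f:V\to\mathbb C$ put $$\tilde\Delta_m f(x)=\frac1{m(x)}\sum_{y\in V}E(x,y)\,(f(x)-f(y)),$$ and let $\Delta_m$ be the Friedrichs extension in $\ell^2(V,m)$ of the restriction of $\tilde\Delta_m$ to the finitely supported functions, with spectrum $\sigma(\Delta_m)$ and essential spectrum $\sigma_{\rm ess}(\Delta_m)$. Let $\lambda^0=\inf\sigma(\Delta_m)$ and $\lambda^0_{\rm ess}=\inf\sigma_{\rm ess}(\Delta_m)\in[0,+\infty]$, with $\inf\emptyset=+\infty$; if $\lambda^0_{\rm ess}=+\infty$, then "$\lambda^0_{\rm ess}-\varepsilon$" below stands for an arbitrary real number (on which $N_1,C,N_2,W$ may then also depend). A 1-dimensional decomposition of $G$ is a partition $V=\bigsqcup_{n\ge0}S_n$ into finite sets such that $E(x,y)>0$, $x\in S_n$, $y\in S_k$ imply $|n-k|\le1$; put $B_N=S_0\cup\dots\cup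 S_N$. (a) For every real $\lambda\le\lambda^0$ there is $W:V\to(0,\infty)$ with $\tilde\Delta_mW(x)\ge\lambda W(x)$ for all $x\in V$. Moreover, for every 1-dimensional decomposition $(S_n)_{n\ge0}$ of $G$: (b) For every $\varepsilon>0$ there are $N_1\ge1$, $C>0$ and $W:V\to(0,\infty)$ with $\tilde\Delta_mW(x)\ge(\lambda^0_{\rm ess}-\varepsilon)W(x)-C\,\mathbf 1_{B_{N_1}}(x)$ for all $x\in V$. (c) If $\inf_{x\in V}m(x)>0$, then for every $\varepsilon>0$ there are $N_2\ge1$ and $W:V\to(0,\infty)$ with $\tilde\Delta_mW(x)\ge(\lambda^0_{\rm ess}-\varepsilon)\,\mathbf 1_{B_{N_2}^c}(x)\,W(x)$ for all $x\in V$. (d) If $V=\mathbb N=\{0,1,2,\dots\}$, $E(n,k)>0$ only when $|n-k|\le1$, and $m(\mathbb N)=\sum_n m(n)=+\infty$, then the conclusion of (c) holds without the assumption $\inf m>0$. -/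

import Mathlib

open MeasureTheory Filter Topology
open scoped ENNReal

noncomputable section

/-! ### Spectrum and essential spectrum of an unbounded operator -/

namespace UnboundedOp

variable {H : Type*} [NormedAddCommGroup H] [InnerProductSpace ℂ H]

/-- `R` is a bounded two-sided inverse of `A - z : D(A) → H`. -/
def IsResolventAt (A : H →ₗ.[ℂ] H) (z : ℂ) (R : H →L[ℂ] H) : Prop :=
  (∀ g : H, ∃ h : R g ∈ A.domain, A ⟨R g, h⟩ - z • R g = g) ∧
    ∀ f : A.domain, R (A f - z • (f : H)) = f

/-- The spectrum `σ(A)`: all `z` for which `A - z` has no bounded inverse. -/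
def spec (A : H →ₗ.[ℂ] H) : Set ℂ :=
  {z | ¬ ∃ R : H →L[ℂ] H, IsResolventAt A z R}

/-- The eigenspace `ker (A - z)`, as a subspace of the domain of `A`. -/
def eigenspace (A : H →ₗ.[ℂ] H) (z : ℂ) : Submodule ℂ A.domain :=
  LinearMap.ker (A.toFun - z • A.domain.subtype)

/-- The discrete spectrum: isolated points of the spectrum which are eigenvalues of finite
multiplicity. -/
def discreteSpec (A : H →ₗ.[ℂ] H) : Set ℂ :=
  {z | z ∈ spec A ∧ (∃ r > 0, ∀ w ∈ spec A, dist w z < r → w = z) ∧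
    eigenspace A z ≠ ⊥ ∧ FiniteDimensional ℂ (eigenspace A z)}

/-- The essential spectrum `σ_ess(A)` (of a self-adjoint operator): the complement of the discrete
spectrum in the spectrum. -/
def essSpec (A : H →ₗ.[ℂ] H) : Set ℂ := spec A \ discreteSpec A

/-- The infimum, in `[-∞, +∞]`, of the real points of `s`; it is `+∞` if there are none.
(The spectra below are those of self-adjoint operators, hence consist of real points.) -/
def bottom (s : Set ℂ) : EReal := sInf ((fun r : ℝ => (r : EReal)) '' {r : ℝ | (r : ℂ) ∈ s})

end UnboundedOp

/-! ### Weighted graphs -/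

/-- A weighted graph: symmetric edge weight `E ≥ 0`, vertex weight `m > 0`, locally finite, with
infinite connected components. Two vertices are neighbors when `0 < E x y`. -/
structure WeightedGraph (V : Type*) where
  E : V → V → ℝ
  m : V → ℝ
  E_nonneg : ∀ x y, 0 ≤ E x y
  E_symm : ∀ x y, E x y = E y x
  m_pos : ∀ x, 0 < m x
  locallyFinite : ∀ x, {y | 0 < E x y}.Finite
  infinite_component : ∀ x, {y | Relation.ReflTransGen (fun a b => 0 < E a b) x y}.Infinite

namespace WeightedGraph

variable {V : Type*} (G : WeightedGraph V)

/-- The algebraic Laplacian `Δ̃ f (x) = (1 / m x) ∑_y E x y (f x - f y)`, for every function `f`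
with values in `ℝ` or `ℂ`. The sum has only finitely many non-zero terms. -/
def algLaplacian {F : Type*} [AddCommGroup F] [Module ℝ F] (f : V → F) (x : V) : F :=
  (G.m x)⁻¹ • ∑ᶠ y, G.E x y • (f x - f y)

/-- The quadratic form `Q(f,f) = ½ ∑_x ∑_y E x y |f x - f y|²`, with value `∞` allowed. -/
def energy (f : V → ℂ) : ℝ≥0∞ :=
  2⁻¹ * ∑' x, ∑' y, ENNReal.ofReal (G.E x y) * ‖f x - f y‖ₑ ^ 2

/-- A 1-dimensional decomposition: finite sets `S 0, S 1, …` partitioning the vertices, with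
edges only inside a set or between consecutive sets. -/
structure IsDecomposition (S : ℕ → Finset V) : Prop where
  partition : ∀ x, ∃! n, x ∈ S n
  edge : ∀ n k, ∀ x ∈ S n, ∀ y ∈ S k, 0 < G.E x y → n ≤ k + 1 ∧ k ≤ n + 1

/-- `B_N = S 0 ∪ ⋯ ∪ S N`. -/
def ball (S : ℕ → Finset V) (N : ℕ) : Set V := {x | ∃ i ≤ N, x ∈ S i}

/-- The measure on `V` giving mass `m x` to `x`. -/
def measure [MeasurableSpace V] : Measure V :=
  Measure.sum fun x => ENNReal.ofReal (G.m x) • Measure.dirac x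

/-- The complex Hilbert space `ℓ²(V, m)`. -/
abbrev ell2 [MeasurableSpace V] : Type _ := Lp ℂ 2 G.measure

theorem finite_support_term (f : V → ℂ) (x : V) :
    (Function.support fun y => G.E x y • (f x - f y)).Finite := by
  refine (G.locallyFinite x).subset fun y hy => ?_
  have : G.E x y ≠ 0 := fun h => hy (by simp [h])
  exact lt_of_le_of_ne (G.E_nonneg x y) this.symm

theorem algLaplacian_add (f g : V → ℂ) :
    G.algLaplacian (f + g) = G.algLaplacian f + G.algLaplacian g := by
  funext x
  simp only [algLaplacian, Pi.add_apply]
  rw [← smul_add, ← finsum_add_distrib (G.finite_support_term f x) (G.finite_support_term g x)]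
  congr 1
  refine finsum_congr fun y => ?_
  rw [← smul_add]
  congr 1
  ring

theorem algLaplacian_smul (c : ℂ) (f : V → ℂ) :
    G.algLaplacian (c • f) = c • G.algLaplacian f := by
  funext x
  simp only [algLaplacian, Pi.smul_apply]
  rw [smul_comm c, smul_finsum' c (G.finite_support_term f x)]
  congr 1
  refine finsum_congr fun y => ?_
  rw [smul_comm c]
  congr 1
  rw [smul_sub]

theorem finite_support_algLaplacian {f : V → ℂ} (hf : (Function.support f).Finite) :
    (Function.support (G.algLaplacian f)).Finite := by
  refine (hf.union (hf.biUnion fun y _ => G.locallyFinite y)).subset fun x hx => ?_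
  by_contra hcon
  simp only [Set.mem_union, Set.mem_iUnion, not_or, not_exists, Set.mem_ofPred_eq] at hcon
  refine hx ?_
  have hfx : f x = 0 := by simpa using hcon.1
  have : ∀ y, G.E x y • (f x - f y) = 0 := by
    intro y
    by_cases hy : f y = 0
    · simp [hfx, hy]
    · have h1 : ¬ 0 < G.E y x := hcon.2 y hy
      have h2 : G.E x y = 0 := by
        rw [G.E_symm]; exact le_antisymm (not_lt.mp h1) (G.E_nonneg y x)
      simp [h2]
  simp [algLaplacian, this]

theorem energy_add_le (f g : V → ℂ) :
    G.energy (f + g) ≤ 2 * G.energy f + 2 * G.energy g := by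
  have key : ∀ a b : ℂ, ‖a + b‖ₑ ^ 2 ≤ 2 * ‖a‖ₑ ^ 2 + 2 * ‖b‖ₑ ^ 2 := by
    intro a b
    have h : ‖a + b‖₊ ^ 2 ≤ 2 * ‖a‖₊ ^ 2 + 2 * ‖b‖₊ ^ 2 := by
      rw [← NNReal.coe_le_coe]
      push_cast
      have h1 := norm_add_le a b
      nlinarith [sq_nonneg (‖a‖ - ‖b‖), norm_nonneg (a + b), norm_nonneg a, norm_nonneg b]
    simp only [enorm_eq_nnnorm]
    exact_mod_cast h
  calc G.energy (f + g)
      ≤ 2⁻¹ * ∑' x, ∑' y, (2 * (ENNReal.ofReal (G.E x y) * ‖f x - f y‖ₑ ^ 2)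
          + 2 * (ENNReal.ofReal (G.E x y) * ‖g x - g y‖ₑ ^ 2)) := by
        unfold energy
        gcongr with x y
        calc ENNReal.ofReal (G.E x y) * ‖(f + g) x - (f + g) y‖ₑ ^ 2
            ≤ ENNReal.ofReal (G.E x y) * (2 * ‖f x - f y‖ₑ ^ 2 + 2 * ‖g x - g y‖ₑ ^ 2) := by
              gcongr
              have h := key (f x - f y) (g x - g y)
              rwa [show f x - f y + (g x - g y) = (f + g) x - (f + g) y by
                simp only [Pi.add_apply]; ring] at h
          _ = _ := by ring
    _ = 2 * G.energy f + 2 * G.energy g := by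
        simp only [energy, ENNReal.tsum_add, ENNReal.tsum_mul_left]
        ring

theorem energy_smul (c : ℂ) (f : V → ℂ) : G.energy (c • f) = ‖c‖ₑ ^ 2 * G.energy f := by
  have : ∀ x y, ENNReal.ofReal (G.E x y) * ‖(c • f) x - (c • f) y‖ₑ ^ 2
      = ‖c‖ₑ ^ 2 * (ENNReal.ofReal (G.E x y) * ‖f x - f y‖ₑ ^ 2) := by
    intro x y
    rw [Pi.smul_apply, Pi.smul_apply, ← smul_sub, enorm_smul]
    ring
  simp only [energy, this, ENNReal.tsum_mul_left]
  ring

section Laplacian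

variable [MeasurableSpace V] [DiscreteMeasurableSpace V]

/-- All points have positive mass, so functions equal almost everywhere are equal. -/
theorem eq_of_ae_eq {F : Type*} {f g : V → F} (h : f =ᵐ[G.measure] g) : f = g := by
  funext x
  by_contra hx
  have h0 : G.measure {y | ¬ f y = g y} = 0 := h
  rw [measure, Measure.sum_apply _ (MeasurableSet.of_discrete), ENNReal.tsum_eq_zero] at h0
  have h1 := h0 x
  rw [Measure.smul_apply, Measure.dirac_apply' _ MeasurableSet.of_discrete] at h1
  simp [Set.indicator, hx] at h1
  exact absurd h1 (not_le.mpr (G.m_pos x))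

theorem coe_add (f g : G.ell2) : ⇑(f + g) = ⇑f + ⇑g := G.eq_of_ae_eq (Lp.coeFn_add f g)

theorem coe_sub (f g : G.ell2) : ⇑(f - g) = ⇑f - ⇑g := G.eq_of_ae_eq (Lp.coeFn_sub f g)

theorem coe_smul (c : ℂ) (f : G.ell2) : ⇑(c • f) = c • ⇑f := G.eq_of_ae_eq (Lp.coeFn_smul c f)

theorem coe_zero : ⇑(0 : G.ell2) = 0 := G.eq_of_ae_eq (Lp.coeFn_zero ℂ 2 G.measure)

theorem coe_toLp {f : V → ℂ} (hf : MemLp f 2 G.measure) : ⇑(hf.toLp f) = f :=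
  G.eq_of_ae_eq hf.coeFn_toLp

/-- `C_c(V)`: the finitely supported functions, as a subspace of `ℓ²(V, m)`. -/
def finSupp : Submodule ℂ G.ell2 where
  carrier := {f | (Function.support ⇑f).Finite}
  zero_mem' := by
    change (Function.support ⇑(0 : G.ell2)).Finite
    rw [coe_zero]
    simp
  add_mem' {f g} hf hg := by
    change (Function.support ⇑(f + g)).Finite
    rw [coe_add]
    exact (Set.Finite.union hf hg).subset (Function.support_add _ _)
  smul_mem' c f hf := by
    change (Function.support ⇑(c • f)).Finite
    rw [coe_smul]
    exact Set.Finite.subset hf (Function.support_const_smul_subset c _)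

theorem memLp_of_finite_support {f : V → ℂ} (hf : (Function.support f).Finite) :
    MemLp f 2 G.measure := by
  have hf' : f = fun x => ∑ y ∈ hf.toFinset, Set.indicator {y} (fun _ => f y) x := by
    funext x
    by_cases hx : f x = 0
    · rw [Finset.sum_eq_zero, hx]
      intro y hy
      by_cases hxy : x = y
      · subst hxy; simp [hx]
      · simp [hxy]
    · rw [Finset.sum_eq_single x]
      · simp
      · intro y _ hxy; simp [hxy.symm]
      · intro h; simp [hx] at h
  rw [hf']
  refine memLp_finsetSum _ fun y _ => memLp_indicator_const 2 MeasurableSet.of_discrete _ (Or.inr ?_)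
  rw [measure, Measure.sum_apply _ (MeasurableSet.of_discrete), tsum_eq_single y]
  · simp
  · intro x hxy
    simp [hxy]

/-- The Laplacian restricted to `C_c(V)`, as a densely defined operator in `ℓ²(V, m)`. -/
def minLaplacian : G.ell2 →ₗ.[ℂ] G.ell2 where
  domain := G.finSupp
  toFun :=
    { toFun := fun f =>
        (G.memLp_of_finite_support (G.finite_support_algLaplacian f.2)).toLp (G.algLaplacian ⇑f.1)
      map_add' := fun f g => by
        refine Lp.ext (Eq.eventuallyEq ?_)
        simp only [coe_toLp, coe_add, Submodule.coe_add, algLaplacian_add]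
      map_smul' := fun c f => by
        refine Lp.ext (Eq.eventuallyEq ?_)
        simp only [coe_toLp, coe_smul, Submodule.coe_smul, algLaplacian_smul, RingHom.id_apply] }

/-- The form domain `D(Δ^{1/2})`: the completion of `C_c(V)` under the norm `‖f‖ + Q(f,f)^{1/2}`,
realized in `ℓ²(V, m)` as the set of all limits, in this norm, of sequences in `C_c(V)`. -/
def formDomain : Submodule ℂ G.ell2 where
  carrier := {f | ∃ g : ℕ → G.ell2, (∀ n, g n ∈ G.finSupp) ∧ Tendsto g atTop (𝓝 f) ∧
    Tendsto (fun n => G.energy ⇑(g n - f)) atTop (𝓝 0)}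
  zero_mem' := ⟨fun _ => 0, fun _ => zero_mem _, tendsto_const_nhds, by
    simp only [sub_self]
    rw [coe_zero]
    simp [energy]⟩
  add_mem' := by
    rintro f f' ⟨g, hg, hgf, hgE⟩ ⟨g', hg', hgf', hgE'⟩
    refine ⟨fun n => g n + g' n, fun n => add_mem (hg n) (hg' n), hgf.add hgf', ?_⟩
    have h := (ENNReal.Tendsto.const_mul (a := 2) hgE (Or.inr (by simp))).add
      (ENNReal.Tendsto.const_mul (a := 2) hgE' (Or.inr (by simp)))
    simp only [mul_zero, add_zero] at h
    refine tendsto_of_tendsto_of_tendsto_of_le_of_le tendsto_const_nhds h (fun _ => zero_le) ?_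
    intro n
    have : ⇑(g n + g' n - (f + f')) = ⇑(g n - f) + ⇑(g' n - f') := by
      rw [← coe_add]; congr 1; abel_nf
    simp only [this]
    exact G.energy_add_le _ _
  smul_mem' := by
    rintro c f ⟨g, hg, hgf, hgE⟩
    refine ⟨fun n => c • g n, fun n => Submodule.smul_mem _ c (hg n), hgf.const_smul c, ?_⟩
    have h := ENNReal.Tendsto.const_mul (a := ‖c‖ₑ ^ 2) hgE (Or.inr (by simp))
    simp only [mul_zero] at h
    refine h.congr fun n => ?_
    rw [← smul_sub, coe_smul, energy_smul]

/-- The Laplacian `Δ_m`: the Friedrichs extension of its restriction to `C_c(V)`, that is, the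
restriction of the adjoint of `minLaplacian` to the intersection of its domain with the form
domain. -/
def laplacian : G.ell2 →ₗ.[ℂ] G.ell2 :=
  G.minLaplacian.adjoint.domRestrict G.formDomain

/-- `λ⁰ = inf σ(Δ_m)`. -/
def specBottom : EReal := UnboundedOp.bottom (UnboundedOp.spec G.laplacian)

/-- `λ⁰_ess = inf σ_ess(Δ_m)`, which is `+∞` if the essential spectrum is empty. -/
def essSpecBottom : EReal := UnboundedOp.bottom (UnboundedOp.essSpec G.laplacian)

end Laplacian

end WeightedGraph

end

/-! Everything reduces to the Allegretto–Piepenbrink principle (`FormGE.exists_supersolution`): if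
the form `Q` dominates a potential `q` on finitely supported functions, then some `W > 0` satisfies
`Δ̃ W ≥ q W`. To prove it, solve `(Δ̃ - q + ε) u = 1` on finite sets, where coercivity gives
existence and positivity, normalise in each component, and pass to a limit along an ultrafilter; the
Harnack inequality keeps values bounded and away from zero. It remains to find `q`, and only for `l
> 0`, since `W = 1` settles `l ≤ 0`.

For (a), `q = l`: the functional calculus of the resolvent `R = (Δ + 1)⁻¹` turns a bound on the
spectrum into a bound on the form.

Below the essential spectrum, let `P` be the spectral projection of `Δ` to `[0, l']` with `l < l' <
λ⁰_ess`. Its range is finite-dimensional, and `Q(f) ≥ l' ‖f - P f‖² + δ ‖P f‖²`, where `δ ≥ 0`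
bounds from below the eigenvalues up to `l'` (`exists_projection`). Elements of a finite-dimensional
space are uniformly small off a large ball `B`, so `P f` is controlled by `f` on `B`.

For (b), dropping `δ` yields `q = l - 2 l' 1_B`, and the negative term times `W` is bounded because
`B` is finite. For (c) and (d), a positive `δ` pays for the tail of `P f` off `B` and yields `q = l
1_{Bᶜ}`. One can take `δ > 0` as soon as `0` is not an eigenvalue. A null vector has zero energy,
hence is constant on components, and a non-zero constant on a component of infinite mass is not
square summable. This is the only role of `inf m > 0` in (c) and of `m(ℕ) = ∞` in (d). -/

noncomputable section

/-! ### Spectral theory of a non-negative operator through its resolvent at `-1`. -/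

namespace UnboundedOp

variable {H : Type*} [NormedAddCommGroup H] [InnerProductSpace ℂ H]

/-- Spectral mapping for the resolvent at `-1`: a non-zero point `a` of its spectrum comes from the
point `a⁻¹ - 1` of the spectrum of the operator. -/
theorem inv_sub_one_mem_spec {A : H →ₗ.[ℂ] H} {R : H →L[ℂ] H} (hR : IsResolventAt A (-1) R)
    {a : ℂ} (ha : a ≠ 0) (hmem : a ∈ spectrum ℂ R) : a⁻¹ - 1 ∈ spec A := by
  rintro ⟨S, hS⟩
  refine hmem ?_
  have h1 : ∀ g, S g = R g + a⁻¹ • R (S g) := by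
    intro g
    obtain ⟨hd, he⟩ := hS.1 g
    have h2 := hR.2 ⟨S g, hd⟩
    have h3 : A ⟨S g, hd⟩ - (-1 : ℂ) • S g = g + a⁻¹ • S g := by
      rw [sub_eq_iff_eq_add.mp he]
      module
    simp only at h2
    rw [h3, map_add, map_smul] at h2
    exact h2.symm
  have h2 : ∀ g, S g = R g + a⁻¹ • S (R g) := by
    intro g
    obtain ⟨hd, he⟩ := hR.1 g
    have h2 := hS.2 ⟨R g, hd⟩
    have h3 : A ⟨R g, hd⟩ - (a⁻¹ - 1) • R g = g - a⁻¹ • R g := by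
      rw [sub_eq_iff_eq_add.mp he]
      module
    simp only at h2
    rw [h3, map_sub, map_smul] at h2
    exact sub_eq_iff_eq_add.mp h2
  let T : H →L[ℂ] H := a⁻¹ • (1 + a⁻¹ • S)
  have hT1 : (algebraMap ℂ (H →L[ℂ] H) a - R) * T = 1 := by
    ext g
    have := h1 g
    have h3 : R (S g) = a • (S g - R g) := by
      rw [this, add_sub_cancel_left, ← this, smul_smul, mul_inv_cancel₀ ha, one_smul]
    simp only [T, Algebra.algebraMap_eq_smul_one, mul_apply_eq_comp,
      sub_apply, smul_apply, add_apply,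
      one_apply_eq_self, map_add, map_smul, h3]
    match_scalars <;> field_simp <;> ring
  have hT2 : T * (algebraMap ℂ (H →L[ℂ] H) a - R) = 1 := by
    ext g
    have := h2 g
    have h3 : S (R g) = a • (S g - R g) := by
      rw [this, add_sub_cancel_left, smul_smul, mul_inv_cancel₀ ha, one_smul]
    simp only [T, Algebra.algebraMap_eq_smul_one, mul_apply_eq_comp,
      sub_apply, smul_apply, add_apply,
      one_apply_eq_self, map_sub, map_smul, h3]
    match_scalars <;> field_simp <;> ring
  exact ⟨⟨_, T, hT1, hT2⟩, rfl⟩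

/-- The quadratic form of `A` is real and non-negative. -/
def IsNonneg (A : H →ₗ.[ℂ] H) : Prop :=
  ∀ f : A.domain, 0 ≤ (inner ℂ (f : H) (A f)).re ∧ (inner ℂ (f : H) (A f)).im = 0

theorem inner_resolvent {A : H →ₗ.[ℂ] H} {R : H →L[ℂ] H} (hR : IsResolventAt A (-1) R) (g : H) :
    ∃ h : R g ∈ A.domain, inner ℂ (R g) g = inner ℂ (R g) (A ⟨R g, h⟩) + (‖R g‖ : ℂ) ^ 2 := by
  obtain ⟨h, he⟩ := hR.1 g
  refine ⟨h, ?_⟩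
  have h1 : inner ℂ (R g) g = inner ℂ (R g) (A ⟨R g, h⟩ - (-1 : ℂ) • R g) := by rw [he]
  rw [h1, inner_sub_right, neg_smul, one_smul, inner_neg_right, sub_neg_eq_add,
    inner_self_eq_norm_sq_to_K]
  rfl

/-- With `h = R g` one has `⟨R g, g⟩ = ⟨h, A h⟩ + ‖h‖²`, which is real. Hence no self-adjointness of
`A` itself has to be established. -/
theorem IsNonneg.isSelfAdjoint_resolvent [CompleteSpace H] {A : H →ₗ.[ℂ] H} (hA : IsNonneg A)
    {R : H →L[ℂ] H} (hR : IsResolventAt A (-1) R) : IsSelfAdjoint R := by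
  rw [ContinuousLinearMap.isSelfAdjoint_iff_isSymmetric,
    LinearMap.isSymmetric_iff_inner_map_self_real]
  intro g
  obtain ⟨h, he⟩ := inner_resolvent hR g
  rw [Complex.conj_eq_iff_im]
  change (inner ℂ (R g) g).im = 0
  rw [he, Complex.add_im, (hA ⟨R g, h⟩).2, zero_add, ← Complex.ofReal_pow, Complex.ofReal_im]

theorem mem_eigenspace_iff {A : H →ₗ.[ℂ] H} {z : ℂ} {f : A.domain} :
    f ∈ eigenspace A z ↔ A f = z • (f : H) := by
  simp only [eigenspace, LinearMap.mem_ker, LinearMap.sub_apply, LinearMap.smul_apply,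
    Submodule.subtype_apply, sub_eq_zero]
  rfl

theorem IsNonneg.eigenvalue_nonneg {A : H →ₗ.[ℂ] H} (hA : IsNonneg A) {r : ℝ}
    (h : eigenspace A r ≠ ⊥) : 0 ≤ r := by
  obtain ⟨f, hf, hf0⟩ := Submodule.exists_mem_ne_zero_of_ne_bot h
  have h1 := (hA f).1
  rw [mem_eigenspace_iff.mp hf, inner_smul_right, inner_self_eq_norm_sq_to_K] at h1
  have h2 : ((r : ℂ) * ((‖(f : H)‖ : ℝ) : ℂ) ^ 2).re = r * ‖(f : H)‖ ^ 2 := by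
    rw [← Complex.ofReal_pow, ← Complex.ofReal_mul, Complex.ofReal_re]
  have h3 : 0 ≤ r * ‖(f : H)‖ ^ 2 := h2 ▸ h1
  have h4 : 0 < ‖(f : H)‖ ^ 2 := by
    have : (f : H) ≠ 0 := fun h => hf0 (Subtype.ext h)
    positivity
  exact nonneg_of_mul_nonneg_left h3 h4

theorem le_of_le_bottom {s : Set ℂ} {l r : ℝ} (h : (l : EReal) ≤ bottom s) (hr : (r : ℂ) ∈ s) :
    l ≤ r :=
  EReal.coe_le_coe_iff.mp (h.trans (sInf_le ⟨r, hr, rfl⟩))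

theorem lt_of_lt_bottom {s : Set ℂ} {l r : ℝ} (h : (l : EReal) < bottom s) (hr : (r : ℂ) ∈ s) :
    l < r :=
  EReal.coe_lt_coe_iff.mp (h.trans_le (sInf_le ⟨r, hr, rfl⟩))

/-- The functional calculus applied to the resolvent turns a pointwise inequality on its spectrum
into an inequality for the quadratic form of the operator. -/
theorem form_ge_of_forall_spectrum [CompleteSpace H] {A : H →ₗ.[ℂ] H} {R : H →L[ℂ] H}
    (hR : IsResolventAt A (-1) R) (hsa : IsSelfAdjoint R) {p : ℝ → ℝ}
    (hp : ContinuousOn p (spectrum ℝ R)) {c d : ℝ}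
    (h : ∀ x ∈ spectrum ℝ R, x * (c + d * p x) * x ≤ x) (f : A.domain) :
    (c - 1) * ‖(f : H)‖ ^ 2 + d * (inner ℂ (f : H) (cfc p R (f : H))).re
      ≤ (inner ℂ (f : H) (A f)).re := by
  set g : H := A f - (-1 : ℂ) • (f : H) with hg
  have hRg : R g = f := hR.2 f
  set P := cfc p R with hP
  -- By hypothesis `k ≥ 0` on the spectrum, so `k(R) = s(R)²` is positive. Since `R g = f`,
  -- expanding `⟨g, k(R) g⟩ ≥ 0` gives `⟨f, A f⟩ + ‖f‖² - c ‖f‖² - d ⟨f, p(R) f⟩ ≥ 0`.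
  let k : ℝ → ℝ := fun x => x - x * (c + d * p x) * x
  let s : ℝ → ℝ := fun x => √(k x)
  have hk : ContinuousOn k (spectrum ℝ R) := by fun_prop
  have hs : ContinuousOn s (spectrum ℝ R) := hk.sqrt
  have hks : cfc s R * cfc s R = cfc k R := by
    rw [← cfc_mul s s R hs hs]
    exact cfc_congr fun x hx => Real.mul_self_sqrt (sub_nonneg.mpr (h x hx))
  have hkR : cfc k R = R - R * (algebraMap ℝ _ c + d • P) * R := by
    have hcd : ContinuousOn (fun x => c + d * p x) (spectrum ℝ R) := by fun_prop
    rw [show k = fun x => id x - (fun x => (fun x => id x * (fun x => c + d * p x) x) x * id x) x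
      from rfl, cfc_sub _ _ R (by fun_prop) (by simp only [id]; fun_prop),
      cfc_mul _ _ R (by simp only [id]; fun_prop) (by fun_prop),
      cfc_mul _ _ R (by fun_prop) hcd, cfc_id ℝ R, cfc_const_add c _ R (by fun_prop),
      cfc_const_mul d p R hp]
  have hsym : ∀ T : H →L[ℂ] H, IsSelfAdjoint T → ∀ u v, inner ℂ (T u) v = inner ℂ u (T v) :=
    fun T hT => ContinuousLinearMap.isSelfAdjoint_iff_isSymmetric.mp hT
  have h0 : 0 ≤ (inner ℂ g (cfc k R g)).re := by
    rw [← hks, mul_apply_eq_comp, ← hsym _ (cfc_predicate s R),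
      inner_self_eq_norm_sq_to_K]
    change 0 ≤ (((‖(cfc s R) g‖ : ℝ) : ℂ) ^ 2).re
    rw [← Complex.ofReal_pow, Complex.ofReal_re]
    positivity
  rw [hkR] at h0
  have h1 : inner ℂ g ((R - R * (algebraMap ℝ (H →L[ℂ] H) c + d • P) * R) g)
      = inner ℂ (f : H) (A f) + inner ℂ (f : H) (f : H)
        - ((c : ℂ) * inner ℂ (f : H) (f : H) + (d : ℂ) * inner ℂ (f : H) (P f)) := by
    rw [sub_apply, inner_sub_right, mul_apply_eq_comp,
      mul_apply_eq_comp, ← hsym R hsa, ← hsym R hsa, hRg]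
    congr 1
    · rw [hg, inner_sub_right, inner_smul_right]; ring
    · rw [Algebra.algebraMap_eq_smul_one, add_apply,
        smul_apply, smul_apply,
        one_apply_eq_self, inner_add_right, ← Complex.coe_smul, ← Complex.coe_smul,
        inner_smul_right, inner_smul_right]
  rw [h1, inner_self_eq_norm_sq_to_K] at h0
  have h2 : ((((‖(f : H)‖ : ℝ) : ℂ)) ^ 2).re = ‖(f : H)‖ ^ 2 := by
    rw [← Complex.ofReal_pow, Complex.ofReal_re]
  simp only [Complex.sub_re, Complex.add_re, Complex.re_ofReal_mul] at h0
  have h3 : ((RCLike.ofReal ‖(f : H)‖ : ℂ) ^ 2).re = ‖(f : H)‖ ^ 2 := h2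
  rw [h3] at h0
  linarith

/-- Since `l > 0`, the point `-1` is in the resolvent set. A non-zero spectral value `x` of `R`
gives the spectral value `x⁻¹ - 1 ≥ l` of `A`, so `(l + 1) x² ≤ x` on the spectrum of `R`. -/
theorem form_ge_of_le_bottom_spec [CompleteSpace H] {A : H →ₗ.[ℂ] H} (hA : IsNonneg A) {l : ℝ}
    (hl0 : 0 < l) (hl : (l : EReal) ≤ bottom (spec A)) (f : A.domain) :
    l * ‖(f : H)‖ ^ 2 ≤ (inner ℂ (f : H) (A f)).re := by
  have h1 : (-1 : ℂ) ∉ spec A := by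
    intro h
    have := le_of_le_bottom (r := -1) hl (by simpa using h)
    linarith
  obtain ⟨R, hR⟩ := not_not.mp h1
  have hsa := hA.isSelfAdjoint_resolvent hR
  have := form_ge_of_forall_spectrum hR hsa (p := fun _ => 0) (c := l + 1) (d := 0)
    continuousOn_const (fun x hx => ?_) f
  · simpa using this
  · rcases eq_or_ne x 0 with rfl | hx0
    · simp
    have h2 : ((x : ℂ))⁻¹ - 1 ∈ spec A := inv_sub_one_mem_spec hR (by exact_mod_cast hx0)
      ((spectrum.algebraMap_mem_iff ℂ).mpr hx)
    have h3 : l ≤ x⁻¹ - 1 := le_of_le_bottom hl (by push_cast; exact h2)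
    have h4 : 0 < x := inv_pos.mp (by linarith)
    have h5 : (l + 1) * x ≤ 1 := by
      rw [← le_div_iff₀ h4, one_div]; linarith
    nlinarith

/-- This makes spectral projections to finitely many isolated points accessible to the continuous
functional calculus. -/
theorem continuousOn_indicator_of_isolated {s t : Set ℝ} (ht : t.Finite)
    (h : ∀ x ∈ t, ∃ r > 0, ∀ y ∈ s, dist y x < r → y = x) :
    ContinuousOn (t.indicator (1 : ℝ → ℝ)) s := by
  intro x _
  by_cases hx : x ∈ t
  · obtain ⟨r, hr, hrs⟩ := h x hx
    refine (continuousWithinAt_const (b := t.indicator (1 : ℝ → ℝ) x)).congr_of_eventuallyEq ?_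
      rfl
    filter_upwards [self_mem_nhdsWithin, mem_nhdsWithin_of_mem_nhds (Metric.ball_mem_nhds x hr)]
      with y hy1 hy2
    rw [hrs y hy1 hy2]
  · refine ContinuousAt.continuousWithinAt
      ((continuousAt_const (y := (0 : ℝ))).congr ?_)
    filter_upwards [ht.isClosed.isOpen_compl.mem_nhds hx] with y hy
    rw [Set.indicator_of_notMem hy]

/-- If `R g = a g`, then `g = R (a⁻¹ g)` lies in the domain and `(A + 1) g = a⁻¹ g`, so the kernel
is contained in an eigenspace of `A`. -/
theorem finiteDimensional_ker_resolvent_sub {A : H →ₗ.[ℂ] H} {R : H →L[ℂ] H}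
    (hR : IsResolventAt A (-1) R) {a : ℂ} (ha : a ≠ 0)
    (hfin : FiniteDimensional ℂ (eigenspace A (a⁻¹ - 1))) :
    FiniteDimensional ℂ (LinearMap.ker ((R : H →ₗ[ℂ] H) - a • LinearMap.id)) := by
  have hfd : FiniteDimensional ℂ ((eigenspace A (a⁻¹ - 1)).map A.domain.subtype) := inferInstance
  refine Submodule.finiteDimensional_of_le (S₂ := (eigenspace A (a⁻¹ - 1)).map A.domain.subtype) ?_
  intro g hg
  have hg' : R g = a • g := by
    simpa [sub_eq_zero] using hg
  obtain ⟨h, he⟩ := hR.1 (a⁻¹ • g)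
  have h1 : R (a⁻¹ • g) = g := by rw [map_smul, hg', smul_smul, inv_mul_cancel₀ ha, one_smul]
  have hgd : g ∈ A.domain := h1 ▸ h
  have h2 : A ⟨g, hgd⟩ - (-1 : ℂ) • g = a⁻¹ • g := by
    have : (⟨R (a⁻¹ • g), h⟩ : A.domain) = ⟨g, hgd⟩ := Subtype.ext h1
    rwa [this, h1] at he
  refine ⟨⟨g, hgd⟩, mem_eigenspace_iff.mpr ?_, rfl⟩
  rw [sub_eq_iff_eq_add.mp h2]
  module

/-- Below the essential spectrum a non-negative operator is controlled by a finite rank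
projection. -/
theorem exists_projection_of_lt_bottom_essSpec [CompleteSpace H] {A : H →ₗ.[ℂ] H}
    (hA : IsNonneg A) {l : ℝ} (hl0 : 0 < l) (hl : (l : EReal) < bottom (essSpec A)) :
    ∃ P : H →L[ℂ] H, FiniteDimensional ℂ (LinearMap.range (P : H →ₗ[ℂ] H)) ∧ IsSelfAdjoint P ∧
      P * P = P ∧ ∃ δ : ℝ, 0 ≤ δ ∧ δ ≤ l ∧ (eigenspace A 0 = ⊥ → 0 < δ) ∧
        ∀ f : A.domain, l * ‖(f : H)‖ ^ 2 - (l - δ) * ‖P f‖ ^ 2 ≤ (inner ℂ (f : H) (A f)).re := by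
  have hdisc : ∀ r : ℝ, (r : ℂ) ∈ spec A → r ≤ l → (r : ℂ) ∈ discreteSpec A := by
    intro r hr hrl
    by_contra hcon
    exact absurd (lt_of_lt_bottom hl ⟨hr, hcon⟩) (not_lt.mpr hrl)
  -- A spectral point at or below `l` is discrete, hence an eigenvalue, hence non-negative; this
  -- excludes `-1`.
  have h1 : (-1 : ℂ) ∉ spec A := by
    intro h
    have h2 := hdisc (-1) (by simpa using h) (by linarith)
    have := hA.eigenvalue_nonneg h2.2.2.1
    linarith
  obtain ⟨R, hR⟩ := not_not.mp h1
  have hsa := hA.isSelfAdjoint_resolvent hR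
  have hspec : ∀ x ∈ spectrum ℝ R, x ≠ 0 → ((x⁻¹ - 1 : ℝ) : ℂ) ∈ spec A := by
    intro x hx hx0
    push_cast
    exact inv_sub_one_mem_spec hR (by exact_mod_cast hx0) ((spectrum.algebraMap_mem_iff ℂ).mpr hx)
  have hnn : ∀ x ∈ spectrum ℝ R, 0 ≤ x := by
    intro x hx
    by_contra! hneg
    have h2 : x⁻¹ < 0 := inv_lt_zero.mpr hneg
    have := hA.eigenvalue_nonneg
      (hdisc _ (hspec x hx hneg.ne) (by linarith)).2.2.1
    linarith
  -- Under `x ↦ x⁻¹ - 1` the condition `x ≥ a` becomes `x⁻¹ - 1 ≤ l`, so `t` carries the discrete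
  -- part at or below `l`. It stays away from `0`, where the spectrum of `R` may accumulate.
  set a : ℝ := (1 + l)⁻¹ with ha
  have ha0 : 0 < a := by positivity
  set t : Set ℝ := spectrum ℝ R ∩ Set.Ici a with ht
  have htpos : ∀ x ∈ t, 0 < x := fun x hx => ha0.trans_le hx.2
  have htd : ∀ x ∈ t, ((x⁻¹ - 1 : ℝ) : ℂ) ∈ discreteSpec A := by
    intro x hx
    refine hdisc _ (hspec x hx.1 (htpos x hx).ne') ?_
    have : x⁻¹ ≤ 1 + l := inv_le_of_inv_le₀ (by positivity) hx.2
    linarith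
  have hiso : ∀ x ∈ t, ∃ r > 0, ∀ y ∈ spectrum ℝ R, dist y x < r → y = x := by
    intro x hx
    obtain ⟨r, hr, hrs⟩ := (htd x hx).2.1
    have hx0 := htpos x hx
    have hc : ContinuousAt (fun y : ℝ => y⁻¹ - 1) x := (continuousAt_inv₀ hx0.ne').sub_const 1
    obtain ⟨r', hr', h2⟩ := Metric.continuousAt_iff.mp hc r hr
    -- The bound by `x` keeps `y` positive, so that `y⁻¹ - 1` is a spectral value of `A`.
    refine ⟨min r' x, lt_min hr' hx0, fun y hy hyx => ?_⟩
    have hy0 : 0 < y := by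
      have := (abs_lt.mp (Real.dist_eq y x ▸ hyx.trans_le (min_le_right _ _))).1
      linarith
    have h3 := hrs _ (hspec y hy hy0.ne') (by
      rw [Complex.dist_eq, ← Complex.ofReal_sub, Complex.norm_real, ← dist_eq_norm]
      exact h2 (hyx.trans_le (min_le_left _ _)))
    have h4 : y⁻¹ - 1 = x⁻¹ - 1 := by exact_mod_cast h3
    exact inv_injective (by linarith)
  -- A compact set of isolated points is finite.
  have htfin : t.Finite := by
    refine ((spectrum.isCompact R).inter_right isClosed_Ici).finite ?_
    rw [isDiscrete_iff_forall_mem_exists_isOpen]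
    intro x hx
    obtain ⟨r, hr, hrs⟩ := hiso x hx
    refine ⟨Metric.ball x r, Metric.isOpen_ball, ?_⟩
    ext y
    simp only [Set.mem_inter_iff, Metric.mem_ball, Set.mem_singleton_iff]
    refine ⟨fun h => hrs y h.2.1 h.1, ?_⟩
    rintro rfl
    exact ⟨by simpa using hr, hx⟩
  have hcont : ∀ u ⊆ t, ContinuousOn (u.indicator (1 : ℝ → ℝ)) (spectrum ℝ R) := fun u hu =>
    continuousOn_indicator_of_isolated (htfin.subset hu) fun x hx => hiso x (hu hx)
  have hpt : ContinuousOn (t.indicator (1 : ℝ → ℝ)) (spectrum ℝ R) := hcont t subset_rfl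
  set P : H →L[ℂ] H := cfc (t.indicator (1 : ℝ → ℝ)) R with hP
  have hPsa : IsSelfAdjoint P := cfc_predicate _ R
  have hPP : P * P = P := by
    rw [hP, ← cfc_mul _ _ R hpt hpt]
    congr 1
    funext x
    by_cases hx : x ∈ t <;> simp [hx]
  have hfin : FiniteDimensional ℂ (LinearMap.range (P : H →ₗ[ℂ] H)) := by
    have hsum : P = ∑ x ∈ htfin.toFinset, cfc (({x} : Set ℝ).indicator (1 : ℝ → ℝ)) R := by
      rw [hP, ← cfc_sum (R := ℝ) _ R htfin.toFinset
        (fun x hx => hcont {x} (Set.singleton_subset_iff.mpr (htfin.mem_toFinset.mp hx)))]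
      congr 1
      funext y
      rw [Finset.sum_apply]
      by_cases hy : y ∈ t
      · rw [Finset.sum_eq_single y]
        · simp [hy]
        · intro b _ hb; simp [hb.symm]
        · intro h; exact absurd (htfin.mem_toFinset.mpr hy) h
      · rw [Finset.sum_eq_zero]
        · simp [hy]
        · intro b hb
          have : y ≠ b := fun h => hy (h ▸ htfin.mem_toFinset.mp hb)
          simp [this]
    -- `P` splits into the projections to single points `x` of `t`, and each of these maps into the
    -- eigenspace of `R` at `x`.
    have hker : ∀ x ∈ t, LinearMap.range
        ((cfc (({x} : Set ℝ).indicator (1 : ℝ → ℝ)) R : H →L[ℂ] H) : H →ₗ[ℂ] H)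
          ≤ LinearMap.ker ((R : H →ₗ[ℂ] H) - (x : ℂ) • LinearMap.id) := by
      rintro x hx _ ⟨g, rfl⟩
      have hc := hcont {x} (Set.singleton_subset_iff.mpr hx)
      have h2 : R * cfc (({x} : Set ℝ).indicator (1 : ℝ → ℝ)) R
          = x • cfc (({x} : Set ℝ).indicator (1 : ℝ → ℝ)) R := by
        rw [← cfc_const_mul x _ R hc]
        conv_lhs => enter [1]; rw [← cfc_id ℝ R]
        rw [← cfc_mul _ _ R (by fun_prop) hc]
        congr 1
        funext y
        by_cases hy : y = x
        · simp [hy]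
        · simp [hy]
      have h3 := congrArg (fun T : H →L[ℂ] H => T g) h2
      simp only [mul_apply_eq_comp, smul_apply] at h3
      rw [LinearMap.mem_ker, LinearMap.sub_apply, LinearMap.smul_apply, LinearMap.id_apply,
        ContinuousLinearMap.coe_coe, ContinuousLinearMap.coe_coe, h3, Complex.coe_smul, sub_self]
    have hfd : ∀ x ∈ htfin.toFinset, FiniteDimensional ℂ
        (LinearMap.ker ((R : H →ₗ[ℂ] H) - (x : ℂ) • LinearMap.id)) := by
      intro x hx
      have hx' := htfin.mem_toFinset.mp hx
      refine finiteDimensional_ker_resolvent_sub hR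
        (by exact_mod_cast (htpos x hx').ne') ?_
      have h4 := (htd x hx').2.2.2
      rwa [Complex.ofReal_sub, Complex.ofReal_inv, Complex.ofReal_one] at h4
    have : FiniteDimensional ℂ (⨆ x ∈ htfin.toFinset,
        LinearMap.ker ((R : H →ₗ[ℂ] H) - (x : ℂ) • LinearMap.id) : Submodule ℂ H) := by
      rw [← Finset.sup_eq_iSup]
      have : ∀ u ⊆ htfin.toFinset, FiniteDimensional ℂ (u.sup fun x =>
          LinearMap.ker ((R : H →ₗ[ℂ] H) - (x : ℂ) • LinearMap.id) : Submodule ℂ H) := by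
        intro u
        induction u using Finset.induction_on with
        | empty => intro _; rw [Finset.sup_empty]; infer_instance
        | insert x u _ ih =>
          intro hu
          have h4 := hfd x (hu (Finset.mem_insert_self x u))
          have h5 := ih ((Finset.subset_insert x u).trans hu)
          rw [Finset.sup_insert]
          infer_instance
      exact this _ subset_rfl
    refine Submodule.finiteDimensional_of_le (S₂ := ⨆ x ∈ htfin.toFinset,
        LinearMap.ker ((R : H →ₗ[ℂ] H) - (x : ℂ) • LinearMap.id)) ?_
    rintro _ ⟨g, rfl⟩
    rw [hsum]
    simp only [ContinuousLinearMap.coe_coe, sum_apply]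
    refine Submodule.sum_mem _ fun x hx => ?_
    exact Submodule.mem_iSup_of_mem x (Submodule.mem_iSup_of_mem hx
      (hker x (htfin.mem_toFinset.mp hx) ⟨g, rfl⟩))
  obtain ⟨δ, hδ0, hδl, hδpos, hδ⟩ : ∃ δ : ℝ, 0 ≤ δ ∧ δ ≤ l ∧ (eigenspace A 0 = ⊥ → 0 < δ) ∧
      ∀ x ∈ t, δ ≤ x⁻¹ - 1 := by
    have hge : ∀ x ∈ t, 0 ≤ x⁻¹ - 1 := fun x hx => hA.eigenvalue_nonneg (htd x hx).2.2.1
    by_cases h0 : eigenspace A 0 = ⊥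
    · have hgt : ∀ x ∈ t, 0 < x⁻¹ - 1 := by
        intro x hx
        refine lt_of_le_of_ne (hge x hx) fun h => (htd x hx).2.2.1 ?_
        rw [← h, Complex.ofReal_zero, h0]
      by_cases hne : t.Nonempty
      · obtain ⟨x, hx, hmin⟩ := htfin.exists_minimalFor (fun x => x⁻¹ - 1) t hne
        refine ⟨min l (x⁻¹ - 1), (lt_min hl0 (hgt x hx)).le, min_le_left _ _,
          fun _ => lt_min hl0 (hgt x hx), fun y hy => ?_⟩
        rcases le_total (x⁻¹ - 1) (y⁻¹ - 1) with h | h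
        · exact (min_le_right _ _).trans h
        · exact (min_le_right _ _).trans (hmin hy h)
      · exact ⟨l, hl0.le, le_rfl, fun _ => hl0, fun x hx => absurd ⟨x, hx⟩ hne⟩
    · exact ⟨0, le_rfl, hl0.le, fun h => absurd h h0, hge⟩
  refine ⟨P, hfin, hPsa, hPP, δ, hδ0, hδl, hδpos, fun f => ?_⟩
  -- The multiplier `c + d 1_t` equals `1 + δ` on `t` and `1 + l` off `t`; the required inequality
  -- says `x ≤ (1 + δ)⁻¹` and `x ≤ (1 + l)⁻¹` for non-zero `x` there.
  have := form_ge_of_forall_spectrum hR hsa (c := l + 1) (d := δ - l) hpt (fun x hx => ?_) f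
  · have h2 : (inner ℂ (f : H) (P f)).re = ‖P f‖ ^ 2 := by
      conv_lhs => rw [← hPP, mul_apply_eq_comp]
      have hsym := ContinuousLinearMap.isSelfAdjoint_iff_isSymmetric.mp hPsa (f : H) (P f)
      simp only [ContinuousLinearMap.coe_coe] at hsym
      rw [← hsym, inner_self_eq_norm_sq_to_K]
      change (((‖P f‖ : ℝ) : ℂ) ^ 2).re = _
      rw [← Complex.ofReal_pow, Complex.ofReal_re]
    rw [← hP, h2] at this
    linarith
  · have hx0 := hnn x hx
    by_cases hxt : x ∈ t
    · have hxp := htpos x hxt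
      have h2 := hδ x hxt
      have h3 : (1 + δ) * x ≤ 1 := by rw [← le_div_iff₀ hxp, one_div]; linarith
      simp only [hxt, Set.indicator_of_mem, Pi.one_apply]
      nlinarith
    · have hxa : x < a := not_le.mp fun h => hxt ⟨hx, h⟩
      have h3 : (1 + l) * x ≤ 1 := by
        have := (mul_lt_mul_of_pos_left hxa (show 0 < 1 + l by positivity)).le
        rwa [ha, mul_inv_cancel₀ (by positivity)] at this
      simp only [hxt, not_false_eq_true, Set.indicator_of_notMem]
      nlinarith

end UnboundedOp

end

noncomputable section

/-! ### Green's formula and the energy of finitely supported functions. -/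

namespace WeightedGraph

variable {V : Type*} (G : WeightedGraph V)

theorem E_eq_zero {x y : V} (h : ¬ 0 < G.E x y) : G.E x y = 0 :=
  le_antisymm (not_lt.mp h) (G.E_nonneg x y)

/-- A finite set containing the support of `f` and the neighbors of the support. -/
theorem exists_finset_nbhd {f : V → ℂ} (hf : (Function.support f).Finite) :
    ∃ T : Finset V, ∀ x, f x ≠ 0 → x ∈ T ∧ ∀ y, 0 < G.E x y → y ∈ T := by
  have h : (Function.support f ∪ ⋃ x ∈ Function.support f, {y | 0 < G.E x y}).Finite :=
    hf.union (hf.biUnion fun y _ => G.locallyFinite y)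
  refine ⟨h.toFinset, fun x hx => ⟨?_, fun y hy => ?_⟩⟩
  · exact h.mem_toFinset.mpr (Or.inl hx)
  · exact h.mem_toFinset.mpr (Or.inr (Set.mem_biUnion (show x ∈ Function.support f from hx) hy))

/-- Green's formula. -/
theorem green {f : V → ℂ} (g : V → ℂ) {T : Finset V}
    (hT : ∀ x, f x ≠ 0 → x ∈ T ∧ ∀ y, 0 < G.E x y → y ∈ T) :
    ∑ x ∈ T, (G.m x : ℂ) * inner ℂ (f x) (G.algLaplacian g x)
      = 2⁻¹ * ∑ x ∈ T, ∑ y ∈ T, (G.E x y : ℂ) * inner ℂ (f x - f y) (g x - g y) := by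
  have h1 : ∀ x ∈ T, (G.m x : ℂ) * inner ℂ (f x) (G.algLaplacian g x)
      = ∑ y ∈ T, (G.E x y : ℂ) * inner ℂ (f x) (g x - g y) := by
    intro x _
    by_cases hx : f x = 0
    · simp [hx]
    have h2 : ∑ᶠ y, G.E x y • (g x - g y) = ∑ y ∈ T, G.E x y • (g x - g y) := by
      refine finsum_eq_sum_of_support_subset _ fun y hy => (hT x hx).2 y ?_
      by_contra h
      exact hy (by simp [G.E_eq_zero h])
    rw [algLaplacian, h2, ← Complex.coe_smul, inner_smul_right, ← mul_assoc, Complex.ofReal_inv,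
      mul_inv_cancel₀ (by exact_mod_cast (G.m_pos x).ne'), one_mul, inner_sum]
    refine Finset.sum_congr rfl fun y _ => ?_
    rw [← Complex.coe_smul, inner_smul_right]
  rw [Finset.sum_congr rfl h1]
  have h3 : ∑ x ∈ T, ∑ y ∈ T, (G.E x y : ℂ) * inner ℂ (f x) (g x - g y)
      = ∑ x ∈ T, ∑ y ∈ T, -((G.E x y : ℂ) * inner ℂ (f y) (g x - g y)) := by
    rw [Finset.sum_comm]
    refine Finset.sum_congr rfl fun x _ => Finset.sum_congr rfl fun y _ => ?_
    rw [G.E_symm y x, ← mul_neg, ← inner_neg_right, neg_sub]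
  have h4 : ∑ x ∈ T, ∑ y ∈ T, (G.E x y : ℂ) * inner ℂ (f x - f y) (g x - g y)
      = ∑ x ∈ T, ∑ y ∈ T, (G.E x y : ℂ) * inner ℂ (f x) (g x - g y)
        + ∑ x ∈ T, ∑ y ∈ T, -((G.E x y : ℂ) * inner ℂ (f y) (g x - g y)) := by
    simp only [← Finset.sum_add_distrib]
    refine Finset.sum_congr rfl fun x _ => Finset.sum_congr rfl fun y _ => ?_
    rw [inner_sub_left]
    ring
  rw [h4, ← h3]
  ring

theorem energy_eq_ofReal_sum {f : V → ℂ} {T : Finset V}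
    (hT : ∀ x, f x ≠ 0 → x ∈ T ∧ ∀ y, 0 < G.E x y → y ∈ T) :
    G.energy f = ENNReal.ofReal (2⁻¹ * ∑ x ∈ T, ∑ y ∈ T, G.E x y * ‖f x - f y‖ ^ 2) := by
  have h0 : ∀ x y, x ∉ T ∨ y ∉ T → ENNReal.ofReal (G.E x y) * ‖f x - f y‖ₑ ^ 2 = 0 := by
    intro x y h
    by_cases hE : 0 < G.E x y
    · have hx : f x = 0 := by
        by_contra hx
        exact h.elim (fun h => h (hT x hx).1) fun h => h ((hT x hx).2 y hE)
      have hy : f y = 0 := by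
        by_contra hy
        exact h.elim (fun h => h ((hT y hy).2 x (G.E_symm x y ▸ hE))) fun h => h (hT y hy).1
      simp [hx, hy]
    · simp [G.E_eq_zero hE]
  rw [energy, tsum_eq_sum (s := T) fun x hx => by simp [fun y => h0 x y (Or.inl hx)],
    ENNReal.ofReal_mul (by norm_num), ENNReal.ofReal_inv_of_pos (by norm_num)]
  congr 1
  · simp
  have hE := G.E_nonneg
  rw [ENNReal.ofReal_sum_of_nonneg fun x _ => Finset.sum_nonneg fun y _ =>
    mul_nonneg (hE x y) (by positivity)]
  refine Finset.sum_congr rfl fun x _ => ?_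
  rw [tsum_eq_sum (s := T) fun y hy => h0 x y (Or.inr hy),
    ENNReal.ofReal_sum_of_nonneg fun y _ => mul_nonneg (hE x y) (by positivity)]
  refine Finset.sum_congr rfl fun y _ => ?_
  rw [ENNReal.ofReal_mul (hE x y), ENNReal.ofReal_pow (norm_nonneg _), ofReal_norm]

theorem energy_eq_zero_imp {f : V → ℂ} (h : G.energy f = 0) {x y : V} (hxy : 0 < G.E x y) :
    f x = f y := by
  rw [energy, mul_eq_zero, ENNReal.tsum_eq_zero] at h
  have h1 := (h.resolve_left (by simp)) x
  rw [ENNReal.tsum_eq_zero] at h1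
  have h2 := (mul_eq_zero.mp (h1 y)).resolve_left (by simpa using hxy)
  simpa [sub_eq_zero] using h2

theorem energy_sub_le (f g h : V → ℂ) :
    G.energy (f - g) ≤ 2 * G.energy (f - h) + 2 * G.energy (g - h) := by
  have h1 := G.energy_add_le (f - h) ((-1 : ℂ) • (g - h))
  rw [G.energy_smul, show f - h + (-1 : ℂ) • (g - h) = f - g by module] at h1
  simpa using h1

theorem IsDecomposition.exists_subset_ball {G : WeightedGraph V} {S : ℕ → Finset V}
    (hS : G.IsDecomposition S) {K : Set V} (hK : K.Finite) : ∃ N, K ⊆ ball S N := by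
  choose n hn using fun x => (hS.partition x).exists
  obtain ⟨N, hN⟩ := (hK.image n).bddAbove
  exact ⟨N, fun x hx => ⟨n x, hN ⟨x, hx, rfl⟩, hn x⟩⟩

theorem ball_mono (S : ℕ → Finset V) {M N : ℕ} (h : M ≤ N) : ball S M ⊆ ball S N :=
  fun _ ⟨i, hi, hx⟩ => ⟨i, hi.trans h, hx⟩

theorem ell2_ext [MeasurableSpace V] {f g : G.ell2} (h : ∀ x, f x = g x) : f = g :=
  Lp.ext (Eq.eventuallyEq (funext h))

/-! ### The Friedrichs Laplacian and its form on `ℓ²(V, m)`. -/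

section ell2

variable [MeasurableSpace V] [DiscreteMeasurableSpace V]

theorem hasSum_integral {F : Type*} [NormedAddCommGroup F] [NormedSpace ℝ F] [CompleteSpace F]
    {f : V → F} (hf : Integrable f G.measure) :
    HasSum (fun x => G.m x • f x) (∫ x, f x ∂G.measure) := by
  have h := hasSum_integral_measure (μ := fun x => ENNReal.ofReal (G.m x) • Measure.dirac x) hf
  have h1 : ∀ x, ∫ y, f y ∂ENNReal.ofReal (G.m x) • Measure.dirac x = G.m x • f x := fun x => by
    rw [integral_smul_measure, integral_dirac, ENNReal.toReal_ofReal (G.m_pos x).le]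
  simp only [h1] at h
  exact h

theorem hasSum_inner (f g : G.ell2) :
    HasSum (fun x => (G.m x : ℂ) * inner ℂ (f x) (g x)) (inner ℂ f g) := by
  have := G.hasSum_integral (L2.integrable_inner (𝕜 := ℂ) f g)
  rw [← L2.inner_def] at this
  simpa only [← Complex.coe_smul, smul_eq_mul] using this

theorem hasSum_norm_sq (f : G.ell2) : HasSum (fun x => G.m x * ‖f x‖ ^ 2) (‖f‖ ^ 2) := by
  have h := Complex.hasSum_re (G.hasSum_inner f f)
  have h1 : (inner ℂ f f).re = ‖f‖ ^ 2 := inner_self_eq_norm_sq (𝕜 := ℂ) f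
  have h2 : ∀ x, ((G.m x : ℂ) * inner ℂ (f x) (f x)).re = G.m x * ‖f x‖ ^ 2 := fun x => by
    rw [Complex.re_ofReal_mul]
    congr 1
    exact inner_self_eq_norm_sq (𝕜 := ℂ) (f x)
  simpa only [h1, h2] using h

/-- A finitely supported function as an element of `ℓ²(V, m)`. -/
def mkFinSupp (f : V → ℂ) (hf : (Function.support f).Finite) : G.finSupp :=
  ⟨(G.memLp_of_finite_support hf).toLp f, by
    change (Function.support ⇑((G.memLp_of_finite_support hf).toLp f)).Finite
    rwa [coe_toLp]⟩

theorem coe_mkFinSupp (f : V → ℂ) (hf : (Function.support f).Finite) :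
    ⇑(G.mkFinSupp f hf : G.ell2) = f :=
  G.coe_toLp (G.memLp_of_finite_support hf)

theorem coe_minLaplacian (f : G.finSupp) :
    ⇑(G.minLaplacian f) = G.algLaplacian ⇑(f : G.ell2) :=
  G.coe_toLp (G.memLp_of_finite_support (G.finite_support_algLaplacian f.2))

theorem dense_finSupp : Dense (G.finSupp : Set G.ell2) := by
  classical
  rw [Submodule.dense_iff_topologicalClosure_eq_top, Submodule.topologicalClosure_eq_top_iff,
    Submodule.eq_bot_iff]
  intro f hf
  refine G.ell2_ext fun x => ?_
  have hs : (Function.support (Pi.single x (1 : ℂ) : V → ℂ)).Finite :=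
    (Set.finite_singleton x).subset Pi.support_single_subset
  have h1 := (Submodule.mem_orthogonal _ _).mp hf _ (G.mkFinSupp _ hs).2
  have h2 := (G.hasSum_inner (G.mkFinSupp _ hs : G.ell2) f).unique (hasSum_single x ?_)
  · rw [h1, coe_mkFinSupp] at h2
    rw [coe_zero]
    have := (mul_eq_zero.mp h2.symm).resolve_left (by exact_mod_cast (G.m_pos x).ne')
    simpa using this
  · intro y hy
    rw [coe_mkFinSupp]
    simp [hy]

theorem inner_minLaplacian (f g : G.finSupp) {T : Finset V}
    (hT : ∀ x, (f : G.ell2) x ≠ 0 → x ∈ T ∧ ∀ y, 0 < G.E x y → y ∈ T) :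
    inner ℂ (f : G.ell2) (G.minLaplacian g)
      = ∑ x ∈ T, (G.m x : ℂ) * inner ℂ ((f : G.ell2) x) (G.algLaplacian (g : G.ell2) x) := by
  have h := G.hasSum_inner (f : G.ell2) (G.minLaplacian g)
  rw [coe_minLaplacian] at h
  refine h.unique (hasSum_sum_of_ne_finset_zero fun x hx => ?_)
  have : (f : G.ell2) x = 0 := by
    by_contra h
    exact hx (hT x h).1
  simp [this]

theorem minLaplacian_isFormalAdjoint : G.minLaplacian.IsFormalAdjoint G.minLaplacian := by
  classical
  intro f g
  obtain ⟨T₁, h₁⟩ := G.exists_finset_nbhd (f := (f : G.ell2)) f.2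
  obtain ⟨T₂, h₂⟩ := G.exists_finset_nbhd (f := (g : G.ell2)) g.2
  have h₁' : ∀ x, (f : G.ell2) x ≠ 0 → x ∈ T₁ ∪ T₂ ∧ ∀ y, 0 < G.E x y → y ∈ T₁ ∪ T₂ :=
    fun x hx => ⟨Finset.mem_union_left _ (h₁ x hx).1,
      fun y hy => Finset.mem_union_left _ ((h₁ x hx).2 y hy)⟩
  have h₂' : ∀ x, (g : G.ell2) x ≠ 0 → x ∈ T₁ ∪ T₂ ∧ ∀ y, 0 < G.E x y → y ∈ T₁ ∪ T₂ :=
    fun x hx => ⟨Finset.mem_union_right _ (h₂ x hx).1,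
      fun y hy => Finset.mem_union_right _ ((h₂ x hx).2 y hy)⟩
  rw [G.inner_minLaplacian f g h₁', ← inner_conj_symm, G.inner_minLaplacian g f h₂',
    G.green _ h₁', G.green _ h₂']
  simp only [map_mul, map_sum, inner_conj_symm, Complex.conj_ofReal, map_inv₀, map_ofNat]

/-- Green's formula with both arguments equal to `g`: every term of the double sum is real and
non-negative. -/
theorem energy_finSupp (g : G.finSupp) :
    G.energy (g : G.ell2) = ENNReal.ofReal (inner ℂ (g : G.ell2) (G.minLaplacian g)).re ∧
      0 ≤ (inner ℂ (g : G.ell2) (G.minLaplacian g)).re ∧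
      (inner ℂ (g : G.ell2) (G.minLaplacian g)).im = 0 := by
  obtain ⟨T, hT⟩ := G.exists_finset_nbhd (f := (g : G.ell2)) g.2
  have h : inner ℂ (g : G.ell2) (G.minLaplacian g)
      = ((2⁻¹ * ∑ x ∈ T, ∑ y ∈ T, G.E x y * ‖(g : G.ell2) x - (g : G.ell2) y‖ ^ 2 : ℝ) : ℂ) := by
    rw [G.inner_minLaplacian g g hT, G.green _ hT]
    simp only [inner_self_eq_norm_sq_to_K]
    push_cast
    rfl
  rw [h, Complex.ofReal_re, Complex.ofReal_im]
  refine ⟨G.energy_eq_ofReal_sum hT, ?_, rfl⟩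
  exact mul_nonneg (by norm_num) (Finset.sum_nonneg fun x _ => Finset.sum_nonneg fun y _ =>
    mul_nonneg (G.E_nonneg x y) (by positivity))

/-- The form of the Laplacian on `C_c(V)`. -/
@[reducible]
def formCore : PreInnerProductSpace.Core ℂ G.finSupp where
  inner f g := inner ℂ (f : G.ell2) (G.minLaplacian g)
  conj_inner_symm f g := by
    rw [inner_conj_symm]
    exact G.minLaplacian_isFormalAdjoint f g
  re_inner_nonneg f := (G.energy_finSupp f).2.1
  add_left f g h := by rw [Submodule.coe_add, inner_add_left]
  smul_left f g c := by rw [Submodule.coe_smul, inner_smul_left]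

/-- Cauchy–Schwarz for the semi-inner product `⟨f, Δ g⟩` on `C_c(V)`. -/
theorem norm_inner_minLaplacian_sq_le (f g : G.finSupp) :
    ENNReal.ofReal (‖inner ℂ (f : G.ell2) (G.minLaplacian g)‖ ^ 2)
      ≤ G.energy (f : G.ell2) * G.energy (g : G.ell2) := by
  have h := @InnerProductSpace.Core.inner_mul_inner_self_le ℂ G.finSupp _ _ _ G.formCore f g
  have h1 : ‖inner ℂ (f : G.ell2) (G.minLaplacian g)‖ * ‖inner ℂ (g : G.ell2) (G.minLaplacian f)‖
      ≤ (inner ℂ (f : G.ell2) (G.minLaplacian f)).re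
        * (inner ℂ (g : G.ell2) (G.minLaplacian g)).re := h
  rw [← G.minLaplacian_isFormalAdjoint g f, norm_inner_symm (G.minLaplacian g), ← sq] at h1
  rw [(G.energy_finSupp f).1, (G.energy_finSupp g).1,
    ← ENNReal.ofReal_mul (G.energy_finSupp f).2.1]
  exact ENNReal.ofReal_le_ofReal h1

theorem laplacian_apply (f : G.laplacian.domain) :
    G.laplacian f = G.minLaplacian.adjoint ⟨f, f.2.2⟩ :=
  @LinearPMap.domRestrict_apply _ _ _ _ _ _ _ _ _ _ _ G.minLaplacian.adjoint G.formDomain f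
    ⟨f, f.2.2⟩ rfl

theorem inner_laplacian (k : G.finSupp) (f : G.laplacian.domain) :
    inner ℂ (k : G.ell2) (G.laplacian f) = inner ℂ (G.minLaplacian k) (f : G.ell2) := by
  have h1 := LinearPMap.adjoint_isFormalAdjoint (T := G.minLaplacian) G.dense_finSupp
    ⟨f, f.2.2⟩ k
  rw [← inner_conj_symm, laplacian_apply, h1, inner_conj_symm]

theorem mem_domain_of_finSupp (f : G.finSupp) :
    ∃ h : (f : G.ell2) ∈ G.laplacian.domain, G.laplacian ⟨f, h⟩ = G.minLaplacian f := by
  have hle := G.minLaplacian_isFormalAdjoint.le_adjoint G.dense_finSupp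
  have h1 : (f : G.ell2) ∈ G.formDomain := ⟨fun _ => f, fun _ => f.2, tendsto_const_nhds, by
    simp only [sub_self]
    rw [coe_zero]
    simp [energy]⟩
  have h2 : (f : G.ell2) ∈ G.minLaplacian.adjoint.domain := hle.1 f.2
  refine ⟨⟨h1, h2⟩, ?_⟩
  rw [laplacian_apply]
  exact (hle.2 rfl).symm

/-- The quadratic form of the Laplacian is the limit of the energies of approximating finitely
supported functions. -/
theorem exists_tendsto_energy (f : G.laplacian.domain) :
    ∃ g : ℕ → G.finSupp, Tendsto (fun n => G.energy ⇑((g n : G.ell2) - f)) atTop (𝓝 0) ∧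
      Tendsto (fun n => inner ℂ (g n : G.ell2) (G.minLaplacian (g n))) atTop
        (𝓝 (inner ℂ (f : G.ell2) (G.laplacian f))) := by
  obtain ⟨g, hg, hgf, hgE⟩ := f.2.1
  let h : ℕ → G.finSupp := fun n => ⟨g n, hg n⟩
  refine ⟨h, hgE, ?_⟩
  have hfin : ∀ k : G.finSupp, G.energy (k : G.ell2) ≠ ⊤ := fun k => by
    rw [(G.energy_finSupp k).1]
    exact ENNReal.ofReal_ne_top
  set e : ℕ → ℝ≥0∞ := fun n => G.energy ⇑(g n - f) with he
  have hsub : ∀ m n, G.energy ⇑((h m - h n : G.finSupp) : G.ell2) ≤ 2 * e m + 2 * e n := by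
    intro m n
    have := G.energy_sub_le (g m) (g n) (f : G.ell2)
    simp only [← coe_sub] at this
    exact this
  -- Cauchy–Schwarz applies only to finitely supported functions, so it is used for `g m - g n`, and
  -- then `m → ∞` at fixed `n`.
  have hbound : ∀ n, ENNReal.ofReal
      (‖inner ℂ ((f : G.ell2) - h n) (G.minLaplacian (h n))‖ ^ 2)
        ≤ 2 * e n * G.energy (h n : G.ell2) := by
    intro n
    have h1 : Tendsto (fun m => ENNReal.ofReal
        (‖inner ℂ (g m - h n : G.ell2) (G.minLaplacian (h n))‖ ^ 2)) atTop (𝓝 (ENNReal.ofReal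
        (‖inner ℂ ((f : G.ell2) - h n) (G.minLaplacian (h n))‖ ^ 2))) := by
      refine ENNReal.tendsto_ofReal (((Tendsto.inner ?_ tendsto_const_nhds).norm).pow 2)
      exact hgf.sub_const _
    have h2 : Tendsto (fun m => (2 * e m + 2 * e n) * G.energy (h n : G.ell2)) atTop
        (𝓝 ((2 * 0 + 2 * e n) * G.energy (h n : G.ell2))) :=
      ENNReal.Tendsto.mul_const ((ENNReal.Tendsto.const_mul hgE (Or.inr (by simp))).add
        tendsto_const_nhds) (Or.inr (hfin _))
    rw [mul_zero, zero_add] at h2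
    refine le_of_tendsto_of_tendsto' h1 h2 fun m => ?_
    exact (G.norm_inner_minLaplacian_sq_le (h m - h n) (h n)).trans
      (mul_le_mul_left (hsub m n) _)
  have hM : ∃ M : ℝ≥0∞, M ≠ ⊤ ∧ ∀ᶠ n in atTop, G.energy (h n : G.ell2) ≤ M := by
    have hev : ∀ᶠ n in atTop, e n < 1 := hgE.eventually_lt_const one_pos
    obtain ⟨N, hN⟩ := hev.exists
    refine ⟨2 * (2 * 1 + 2 * 1) + 2 * G.energy (h N : G.ell2), by
      simp [ENNReal.mul_eq_top, ENNReal.add_eq_top, hfin], ?_⟩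
    filter_upwards [hev] with n hn
    have h1 := G.energy_add_le ⇑((h n - h N : G.finSupp) : G.ell2) (h N : G.ell2)
    rw [← coe_add, Submodule.coe_sub, sub_add_cancel] at h1
    refine h1.trans ?_
    gcongr
    refine (hsub n N).trans ?_
    gcongr
  obtain ⟨M, hMtop, hM⟩ := hM
  have hz : Tendsto (fun n => inner ℂ ((f : G.ell2) - h n) (G.minLaplacian (h n))) atTop
      (𝓝 0) := by
    have h1 : Tendsto (fun n => ENNReal.ofReal
        (‖inner ℂ ((f : G.ell2) - h n) (G.minLaplacian (h n))‖ ^ 2)) atTop (𝓝 0) := by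
      have h2 : Tendsto (fun n => 2 * e n * M) atTop (𝓝 (2 * 0 * M)) :=
        ENNReal.Tendsto.mul_const (ENNReal.Tendsto.const_mul hgE (Or.inr (by simp)))
          (Or.inr hMtop)
      rw [mul_zero, zero_mul] at h2
      refine tendsto_of_tendsto_of_tendsto_of_le_of_le' tendsto_const_nhds h2
        (Eventually.of_forall fun _ => zero_le) ?_
      filter_upwards [hM] with n hn
      refine (hbound n).trans ?_
      gcongr
    have h3 := (ENNReal.tendsto_toReal ENNReal.zero_ne_top).comp h1
    have h4 : Tendsto (fun n => ‖inner ℂ ((f : G.ell2) - h n) (G.minLaplacian (h n))‖ ^ 2)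
        atTop (𝓝 0) := by
      refine h3.congr fun n => ?_
      rw [Function.comp_apply, ENNReal.toReal_ofReal (by positivity)]
    have h5 := h4.sqrt
    rw [Real.sqrt_zero] at h5
    exact tendsto_zero_iff_norm_tendsto_zero.mpr
      (h5.congr fun n => Real.sqrt_sq (norm_nonneg _))
  -- As `⟨g n, Δ f⟩ = ⟨Δ (g n), f⟩`, it differs from `⟨g n, Δ (g n)⟩` by the conjugate of the
  -- quantity that `hz` sends to zero.
  have hb : Tendsto (fun n => inner ℂ (h n : G.ell2) (G.laplacian f)) atTop
      (𝓝 (inner ℂ (f : G.ell2) (G.laplacian f))) := hgf.inner tendsto_const_nhds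
  have hz' := (Complex.continuous_conj.tendsto 0).comp hz
  rw [map_zero] at hz'
  have := hb.sub hz'
  rw [sub_zero] at this
  refine this.congr fun n => ?_
  rw [Function.comp_apply, inner_conj_symm, inner_laplacian, ← inner_sub_right, sub_sub_cancel]
  exact G.minLaplacian_isFormalAdjoint (h n) (h n)

theorem laplacian_isNonneg : UnboundedOp.IsNonneg G.laplacian := by
  intro f
  obtain ⟨g, -, h⟩ := G.exists_tendsto_energy f
  constructor
  · exact ge_of_tendsto' ((Complex.continuous_re.tendsto _).comp h) fun n =>
      (G.energy_finSupp (g n)).2.1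
  · refine tendsto_nhds_unique ((Complex.continuous_im.tendsto _).comp h) ?_
    exact tendsto_const_nhds.congr fun n => ((G.energy_finSupp (g n)).2.2).symm

/-- The energies of the approximants tend to `⟨f, Δ f⟩ = 0`, and the energy of `f` is at most twice
theirs plus twice the energy of the error. -/
theorem energy_eq_zero_of_laplacian_eq_zero {f : G.laplacian.domain} (hf : G.laplacian f = 0) :
    G.energy (f : G.ell2) = 0 := by
  obtain ⟨g, hgE, h⟩ := G.exists_tendsto_energy f
  rw [hf, inner_zero_right] at h
  have h1 : Tendsto (fun n => G.energy (g n : G.ell2)) atTop (𝓝 0) := by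
    have h2 := ENNReal.tendsto_ofReal ((Complex.continuous_re.tendsto _).comp h)
    rw [Complex.zero_re, ENNReal.ofReal_zero] at h2
    exact h2.congr fun n => ((G.energy_finSupp (g n)).1).symm
  have h3 : Tendsto (fun n => 2 * G.energy (g n : G.ell2) + 2 * G.energy ⇑((g n : G.ell2) - f))
      atTop (𝓝 (2 * 0 + 2 * 0)) :=
    (ENNReal.Tendsto.const_mul h1 (Or.inr (by simp))).add
      (ENNReal.Tendsto.const_mul hgE (Or.inr (by simp)))
  rw [mul_zero, add_zero] at h3
  refine le_antisymm (ge_of_tendsto' h3 fun n => ?_) zero_le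
  have h4 := G.energy_add_le (g n : G.ell2) ((-1 : ℂ) • ⇑((g n : G.ell2) - f))
  rw [G.energy_smul, coe_sub,
    show ⇑(g n : G.ell2) + (-1 : ℂ) • (⇑(g n : G.ell2) - ⇑(f : G.ell2)) = ⇑(f : G.ell2) by
      module] at h4
  rw [coe_sub]
  simpa using h4

/-- Without non-zero functions of zero energy, `0` is not an eigenvalue. -/
theorem eigenspace_zero_eq_bot (h : ∀ f : G.ell2, G.energy f = 0 → f = 0) :
    UnboundedOp.eigenspace G.laplacian 0 = ⊥ := by
  rw [Submodule.eq_bot_iff]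
  intro f hf
  rw [UnboundedOp.mem_eigenspace_iff, zero_smul] at hf
  exact Subtype.ext (h _ (G.energy_eq_zero_of_laplacian_eq_zero hf))

/-! ### Restriction to sets and uniform smallness off large balls. -/

/-- Multiplication with the indicator function of `s`. -/
def cutoff (s : Set V) (f : G.ell2) : G.ell2 :=
  ((Lp.memLp f).indicator (MeasurableSet.of_discrete (s := s))).toLp _

theorem coe_cutoff (s : Set V) (f : G.ell2) : ⇑(G.cutoff s f) = s.indicator f := G.coe_toLp _

theorem cutoff_add (s : Set V) (f g : G.ell2) :
    G.cutoff s (f + g) = G.cutoff s f + G.cutoff s g :=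
  G.ell2_ext fun x => by
    rw [coe_cutoff, coe_add, coe_add, Set.indicator_add', coe_cutoff, coe_cutoff]

theorem cutoff_smul (s : Set V) (c : ℂ) (f : G.ell2) : G.cutoff s (c • f) = c • G.cutoff s f :=
  G.ell2_ext fun x => by
    rw [coe_cutoff, coe_smul, coe_smul, coe_cutoff, Pi.smul_apply]
    by_cases hx : x ∈ s <;> simp [hx]

theorem norm_cutoff_le (s : Set V) (f : G.ell2) : ‖G.cutoff s f‖ ≤ ‖f‖ := by
  refine abs_le_of_sq_le_sq' ?_ (norm_nonneg _) |>.2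
  refine hasSum_le (fun x => ?_) (G.hasSum_norm_sq _) (G.hasSum_norm_sq f)
  rw [coe_cutoff]
  have := (G.m_pos x).le
  gcongr
  exact norm_indicator_le_norm_self _ _

theorem inner_cutoff_left (s : Set V) (f g : G.ell2) :
    inner ℂ (G.cutoff s f) g = inner ℂ f (G.cutoff s g) := by
  refine (G.hasSum_inner _ _).unique ?_
  have h := G.hasSum_inner f (G.cutoff s g)
  rw [coe_cutoff] at h ⊢
  have h1 : ∀ x, inner ℂ (s.indicator f x) (g x) = inner ℂ (f x) (s.indicator g x) := fun x => by
    by_cases hx : x ∈ s <;> simp [hx]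
  simpa only [h1] using h

theorem cutoff_add_cutoff_compl (s : Set V) (f : G.ell2) :
    G.cutoff s f + G.cutoff sᶜ f = f :=
  G.ell2_ext fun x => by
    rw [coe_add, coe_cutoff, coe_cutoff, Set.indicator_self_add_compl]

theorem cutoff_sum {ι : Type*} (s : Set V) (t : Finset ι) (f : ι → G.ell2) :
    G.cutoff s (∑ i ∈ t, f i) = ∑ i ∈ t, G.cutoff s (f i) :=
  map_sum (⟨⟨G.cutoff s, by simpa using G.cutoff_smul s 0 0⟩, G.cutoff_add s⟩ : G.ell2 →+ G.ell2)
    f t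

theorem IsDecomposition.tendsto_norm_cutoff {G : WeightedGraph V} {S : ℕ → Finset V}
    (hS : G.IsDecomposition S) (f : G.ell2) :
    Tendsto (fun N => ‖G.cutoff (ball S N)ᶜ f‖) atTop (𝓝 0) := by
  rw [Metric.tendsto_atTop]
  intro ε hε
  obtain ⟨g, hg, hgf⟩ := Metric.dense_iff.mp G.dense_finSupp f ε hε
  obtain ⟨N, hN⟩ := hS.exists_subset_ball (K := Function.support ⇑g) hgf
  refine ⟨N, fun n hn => ?_⟩
  have h1 : G.cutoff (ball S n)ᶜ g = 0 := G.ell2_ext fun x => by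
    rw [coe_cutoff, coe_zero]
    by_cases hx : g x = 0
    · simp [Set.indicator, hx]
    · exact Set.indicator_of_notMem (not_not.mpr (ball_mono S hn (hN hx))) _
  have h2 : G.cutoff (ball S n)ᶜ f = G.cutoff (ball S n)ᶜ (f - g) := by
    conv_lhs => rw [← sub_add_cancel f g, cutoff_add, h1, add_zero]
  rw [Real.dist_eq, sub_zero, abs_norm, h2]
  refine (G.norm_cutoff_le _ _).trans_lt ?_
  rwa [← dist_eq_norm, dist_comm]

/-- Functions in a finite-dimensional space are uniformly small outside of large balls. -/
theorem IsDecomposition.exists_norm_cutoff_le {G : WeightedGraph V} {S : ℕ → Finset V}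
    (hS : G.IsDecomposition S) (F : Submodule ℂ G.ell2) [FiniteDimensional ℂ F] {η : ℝ}
    (hη : 0 < η) : ∃ N, 1 ≤ N ∧ ∀ u ∈ F, ‖G.cutoff (ball S N)ᶜ u‖ ≤ η * ‖u‖ := by
  let b := stdOrthonormalBasis ℂ F
  have h1 : Tendsto (fun N => ∑ i, ‖G.cutoff (ball S N)ᶜ (b i)‖) atTop (𝓝 0) := by
    have := tendsto_finsetSum Finset.univ fun i _ => hS.tendsto_norm_cutoff (b i : G.ell2)
    simpa using this
  obtain ⟨N, hN, hN1⟩ := ((h1.eventually_le_const hη).and (eventually_ge_atTop 1)).exists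
  refine ⟨N, hN1, fun u hu => ?_⟩
  have h2 : u = ∑ i, inner ℂ (b i) (⟨u, hu⟩ : F) • (b i : G.ell2) := by
    have := congrArg (F.subtype) (b.sum_repr' ⟨u, hu⟩)
    simpa using this.symm
  conv_lhs => rw [h2, cutoff_sum]
  refine (norm_sum_le _ _).trans ?_
  refine le_trans ?_ (mul_le_mul_of_nonneg_right hN (norm_nonneg u))
  rw [Finset.sum_mul]
  refine Finset.sum_le_sum fun i _ => ?_
  rw [cutoff_smul, norm_smul, mul_comm]
  refine mul_le_mul_of_nonneg_left ?_ (norm_nonneg _)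
  have := norm_inner_le_norm (𝕜 := ℂ) (b i) (⟨u, hu⟩ : F)
  simpa using this

end ell2

end WeightedGraph

end

noncomputable section

/-! ### Harnack inequality and the Allegretto–Piepenbrink theorem. -/

namespace WeightedGraph

variable {V : Type*} (G : WeightedGraph V)

/-- The Laplacian as a sum over the neighbors. -/
theorem algLaplacian_eq_sum {F : Type*} [AddCommGroup F] [Module ℝ F] (f : V → F) (x : V) :
    G.algLaplacian f x
      = (G.m x)⁻¹ • ∑ y ∈ (G.locallyFinite x).toFinset, G.E x y • (f x - f y) := by
  rw [algLaplacian, finsum_eq_sum_of_support_subset]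
  intro y hy
  have : G.E x y ≠ 0 := fun h => hy (by simp [h])
  simpa using lt_of_le_of_ne (G.E_nonneg x y) this.symm

theorem algLaplacian_add_real (f g : V → ℝ) (x : V) :
    G.algLaplacian (f + g) x = G.algLaplacian f x + G.algLaplacian g x := by
  simp only [algLaplacian_eq_sum, smul_eq_mul, ← mul_add, ← Finset.sum_add_distrib, Pi.add_apply]
  congr 1
  exact Finset.sum_congr rfl fun y _ => by ring

theorem algLaplacian_smul_real (c : ℝ) (f : V → ℝ) (x : V) :
    G.algLaplacian (c • f) x = c * G.algLaplacian f x := by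
  simp only [algLaplacian_eq_sum, smul_eq_mul, Pi.smul_apply, Finset.mul_sum]
  exact Finset.sum_congr rfl fun y _ => by ring

theorem algLaplacian_le_of_le {f g : V → ℝ} {x : V} (hx : f x = g x) (h : ∀ y, g y ≤ f y) :
    G.algLaplacian f x ≤ G.algLaplacian g x := by
  simp only [algLaplacian_eq_sum, smul_eq_mul]
  have := G.m_pos x
  gcongr with y hy
  · exact G.E_nonneg x y
  · exact hx.le
  · exact h y

/-- The weighted degree. -/
def deg (x : V) : ℝ := ∑ y ∈ (G.locallyFinite x).toFinset, G.E x y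

theorem m_mul_algLaplacian (f : V → ℝ) (x : V) :
    G.m x * G.algLaplacian f x
      = G.deg x * f x - ∑ y ∈ (G.locallyFinite x).toFinset, G.E x y * f y := by
  rw [algLaplacian_eq_sum, smul_eq_mul, mul_inv_cancel_left₀ (G.m_pos x).ne', deg, Finset.sum_mul,
    ← Finset.sum_sub_distrib]
  exact Finset.sum_congr rfl fun y _ => by simp only [smul_eq_mul]; ring

/-- A supersolution controls its values at the neighbors. -/
theorem harnack {f : V → ℝ} {c : ℝ} {x y : V} (hf : ∀ z, 0 ≤ f z) (hxy : 0 < G.E x y)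
    (h : c * f x ≤ G.algLaplacian f x) :
    f y ≤ (G.deg x - c * G.m x) / G.E x y * f x := by
  have h1 := G.m_mul_algLaplacian f x
  have h2 : G.E x y * f y ≤ ∑ y ∈ (G.locallyFinite x).toFinset, G.E x y * f y :=
    Finset.single_le_sum (f := fun y => G.E x y * f y)
      (fun z _ => mul_nonneg (G.E_nonneg x z) (hf z)) (by simpa using hxy)
  have h3 := mul_le_mul_of_nonneg_left h (G.m_pos x).le
  rw [div_mul_eq_mul_div, le_div_iff₀ hxy]
  linarith

/-- The quadratic form of the Laplacian dominates the potential `q`, on finitely supported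
functions. -/
def FormGE (q : V → ℝ) : Prop :=
  ∀ (K : Finset V) (f : V → ℝ), (∀ x ∉ K, f x = 0) →
    ∑ x ∈ K, G.m x * (q x * f x ^ 2) ≤ ∑ x ∈ K, G.m x * (f x * G.algLaplacian f x)

/-- On a finite set there is a positive strict supersolution with Dirichlet boundary condition. -/
theorem FormGE.exists_finite_supersolution {G : WeightedGraph V} {q : V → ℝ} (hq : G.FormGE q)
    (K : Finset V) {ε : ℝ} (hε : 0 < ε) :
    ∃ u : V → ℝ, (∀ x, 0 ≤ u x) ∧ (∀ x ∈ K, 0 < u x) ∧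
      ∀ x ∈ K, (q x - ε) * u x ≤ G.algLaplacian u x := by
  classical
  -- The form bound leaves a surplus `ε ‖f‖²`, which forces `f = 0`. This is used twice: for
  -- injectivity of the Dirichlet problem, and with `f` the negative part of the solution.
  have hcoer : ∀ f : V → ℝ, (∀ x ∉ K, f x = 0) →
      (∀ x ∈ K, f x * (G.algLaplacian f x - (q x - ε) * f x) ≤ 0) → ∀ x ∈ K, f x = 0 := by
    intro f hf h
    have h1 := hq K f hf
    have h2 : ∑ x ∈ K, G.m x * (f x * (G.algLaplacian f x - (q x - ε) * f x)) ≤ 0 :=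
      Finset.sum_nonpos fun x hx => mul_nonpos_of_nonneg_of_nonpos (G.m_pos x).le (h x hx)
    have h3 : ∑ x ∈ K, G.m x * (f x * (G.algLaplacian f x - (q x - ε) * f x))
        = ∑ x ∈ K, G.m x * (f x * G.algLaplacian f x) - ∑ x ∈ K, G.m x * (q x * f x ^ 2)
          + ∑ x ∈ K, ε * G.m x * f x ^ 2 := by
      rw [← Finset.sum_sub_distrib, ← Finset.sum_add_distrib]
      exact Finset.sum_congr rfl fun x _ => by ring
    have hnn : ∀ x ∈ K, 0 ≤ ε * G.m x * f x ^ 2 := fun x _ => by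
      have := G.m_pos x
      positivity
    have h4 : ∑ x ∈ K, ε * G.m x * f x ^ 2 = 0 :=
      le_antisymm (by linarith) (Finset.sum_nonneg hnn)
    intro x hx
    have h5 := (Finset.sum_eq_zero_iff_of_nonneg hnn).mp h4 x hx
    have h6 : ε * G.m x ≠ 0 := (mul_pos hε (G.m_pos x)).ne'
    exact pow_eq_zero_iff two_ne_zero |>.mp ((mul_eq_zero.mp h5).resolve_left h6)
  let ext : (K → ℝ) → V → ℝ := fun f x => if h : x ∈ K then f ⟨x, h⟩ else 0
  have ext_mem : ∀ (f : K → ℝ) (x : K), ext f x = f x := fun f x => by simp [ext]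
  have ext_notMem : ∀ (f : K → ℝ), ∀ x ∉ K, ext f x = 0 := fun f x hx => by simp [ext, hx]
  have ext_add : ∀ f g, ext (f + g) = ext f + ext g := fun f g => by
    funext x
    by_cases hx : x ∈ K <;> simp [ext, hx]
  have ext_smul : ∀ (c : ℝ) f, ext (c • f) = c • ext f := fun c f => by
    funext x
    by_cases hx : x ∈ K <;> simp [ext, hx]
  let L : (K → ℝ) →ₗ[ℝ] (K → ℝ) :=
    { toFun := fun f x => G.algLaplacian (ext f) x - (q x - ε) * f x
      map_add' := fun f g => by
        funext x
        simp only [ext_add, algLaplacian_add_real, Pi.add_apply]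
        ring
      map_smul' := fun c f => by
        funext x
        simp only [ext_smul, algLaplacian_smul_real, Pi.smul_apply, smul_eq_mul,
          RingHom.id_apply]
        ring }
  have hinj : Function.Injective L := by
    rw [← LinearMap.ker_eq_bot, LinearMap.ker_eq_bot']
    intro f hf
    funext x
    rw [← ext_mem f x]
    refine hcoer (ext f) (ext_notMem f) (fun y hy => ?_) x x.2
    have := congrFun hf ⟨y, hy⟩
    change G.algLaplacian (ext f) y - (q y - ε) * f ⟨y, hy⟩ = 0 at this
    rw [← ext_mem f ⟨y, hy⟩] at this
    rw [this, mul_zero]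
  obtain ⟨f, hf⟩ := LinearMap.injective_iff_surjective.mp hinj 1
  have hu : ∀ x ∈ K, G.algLaplacian (ext f) x - (q x - ε) * ext f x = 1 := by
    intro x hx
    have := congrFun hf ⟨x, hx⟩
    change G.algLaplacian (ext f) x - (q x - ε) * f ⟨x, hx⟩ = 1 at this
    rwa [← ext_mem f ⟨x, hx⟩] at this
  set u := ext f with hudef
  have hnn : ∀ x, 0 ≤ u x := by
    intro x
    by_cases hx : x ∈ K
    · have h0 := hcoer (fun x => max (-u x) 0)
        (fun x hx => by simp [hudef, ext_notMem f x hx]) (fun y hy => ?_) x hx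
      · have : -u x ≤ 0 := h0 ▸ le_max_left (-u x) 0
        linarith
      rcases le_total (-u y) 0 with h | h
      · simp [max_eq_right h]
      · have h1 : G.algLaplacian (fun x => max (-u x) 0) y ≤ G.algLaplacian ((-1 : ℝ) • u) y :=
          G.algLaplacian_le_of_le (by simp [max_eq_left h]) fun z => by simp
        rw [algLaplacian_smul_real] at h1
        have h2 := hu y hy
        simp only [max_eq_left h]
        refine mul_nonpos_of_nonneg_of_nonpos h ?_
        linarith
    · exact (ext_notMem f x hx).ge
  refine ⟨u, hnn, fun x hx => ?_, fun x hx => by linarith [hu x hx]⟩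
  refine lt_of_le_of_ne (hnn x) fun h => ?_
  -- At a zero of `u ≥ 0` the Laplacian is non-positive, whereas the equation makes it `1` there.
  have h1 : G.algLaplacian u x ≤ G.algLaplacian ((0 : ℝ) • u) x :=
    G.algLaplacian_le_of_le (by simp [← h]) fun z => by simp [hnn z]
  rw [algLaplacian_smul_real, zero_mul] at h1
  have h2 := hu x hx
  rw [← h] at h2
  linarith

/-- Two vertices are in the same component. -/
def componentSetoid : Setoid V where
  r := Relation.ReflTransGen fun a b => 0 < G.E a b
  iseqv :=
    { refl := fun _ => Relation.ReflTransGen.refl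
      symm := fun h => by
        have : Std.Symm fun a b => 0 < G.E a b := ⟨fun a b h => G.E_symm a b ▸ h⟩
        exact Relation.ReflTransGen.stdSymm.symm _ _ h
      trans := fun h h' => h.trans h' }

/-- A chosen vertex in the component of `x`. -/
def root (x : V) : V := (Quotient.mk G.componentSetoid x).out

theorem root_reach (x : V) : Relation.ReflTransGen (fun a b => 0 < G.E a b) (G.root x) x :=
  Quotient.exact (s := G.componentSetoid) (Quotient.out_eq _)

theorem root_eq {x y : V} (h : 0 < G.E x y) : G.root x = G.root y := by
  have : Quotient.mk G.componentSetoid x = Quotient.mk G.componentSetoid y :=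
    Quotient.sound (Relation.ReflTransGen.single h)
  rw [root, root, this]

theorem root_root (x : V) : G.root (G.root x) = G.root x := by
  rw [root, root, Quotient.out_eq]

/-- The theorem of Allegretto and Piepenbrink: if the form is at least `q`, there is a positive
supersolution. -/
theorem FormGE.exists_supersolution {G : WeightedGraph V} {q : V → ℝ} (hq : G.FormGE q) :
    ∃ W : V → ℝ, (∀ x, 0 < W x) ∧ ∀ x, q x * W x ≤ G.algLaplacian W x := by
  classical
  choose u hnn hpos hsup using fun i : Finset V × ℕ =>
    hq.exists_finite_supersolution i.1 (ε := 1 / ((i.2 : ℝ) + 1)) (by positivity)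
  -- Neighbours share a root, so the normalisation is a constant factor in each component and
  -- commutes with the Laplacian.
  let v : Finset V × ℕ → V → ℝ := fun i x => u i x / u i (G.root x)
  have hev : ∀ x : V, ∀ᶠ i : Finset V × ℕ in atTop, x ∈ i.1 := fun x => by
    filter_upwards [eventually_ge_atTop (({x} : Finset V), 0)] with i hi
    exact hi.1 (Finset.mem_singleton_self x)
  have hvnn : ∀ i x, 0 ≤ v i x := fun i x => div_nonneg (hnn i x) (hnn i _)
  have hvL : ∀ i x, G.algLaplacian (v i) x = G.algLaplacian (u i) x / u i (G.root x) := by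
    intro i x
    simp only [algLaplacian_eq_sum, smul_eq_mul]
    rw [mul_div_assoc, Finset.sum_div]
    congr 1
    refine Finset.sum_congr rfl fun y hy => ?_
    have : G.root x = G.root y := G.root_eq (by simpa using hy)
    simp only [v, ← this]
    ring
  have hvsup : ∀ x, ∀ᶠ i in atTop,
      (q x - 1 / ((i.2 : ℝ) + 1)) * v i x ≤ G.algLaplacian (v i) x := by
    intro x
    filter_upwards [hev x] with i hi
    rw [hvL, ← mul_div_assoc]
    exact div_le_div_of_nonneg_right (hsup i x hi) (hnn i _)
  have hstep : ∀ x y, 0 < G.E x y → ∃ C > 0, ∀ᶠ i in atTop, v i y ≤ C * v i x := by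
    intro x y hxy
    -- All errors `1 / (n + 1)` are at most `1`, so `q x - 1` gives a Harnack constant independent
    -- of `i`; the maximum with `1` makes it positive.
    refine ⟨max ((G.deg x - (q x - 1) * G.m x) / G.E x y) 1, by positivity, ?_⟩
    filter_upwards [hvsup x] with i hi
    refine (G.harnack (hvnn i) hxy (c := q x - 1) (le_trans ?_ hi)).trans ?_
    · refine mul_le_mul_of_nonneg_right ?_ (hvnn i x)
      have : 1 / ((i.2 : ℝ) + 1) ≤ 1 := by
        rw [div_le_one (by positivity)]
        linarith [(Nat.cast_nonneg i.2 : (0 : ℝ) ≤ i.2)]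
      linarith
    · exact mul_le_mul_of_nonneg_right (le_max_left _ _) (hvnn i x)
  have hbd : ∀ x, ∃ c > 0, ∃ C, ∀ᶠ i in atTop, v i x ∈ Set.Icc c C := by
    intro x
    have hroot := G.root_root x
    have hreach := G.root_reach x
    revert hroot hreach
    generalize G.root x = r
    intro hroot hreach
    induction hreach with
    | refl =>
      refine ⟨1, one_pos, 1, ?_⟩
      filter_upwards [hev r] with i hi
      simp only [v, hroot, div_self (hpos i _ hi).ne', Set.Icc_self, Set.mem_singleton_iff]
    | @tail y z _ hyz ih =>
      obtain ⟨c, hc, C, hcC⟩ := ih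
      obtain ⟨C₁, hC₁, h1⟩ := hstep y z hyz
      obtain ⟨C₂, hC₂, h2⟩ := hstep z y (G.E_symm y z ▸ hyz)
      -- Harnack along the edge in one direction gives the upper bound, in the other the lower
      -- bound; the path starts at the root, where the value is `1`.
      refine ⟨c / C₂, by positivity, C₁ * C, ?_⟩
      filter_upwards [hcC, h1, h2] with i hi hi1 hi2
      refine ⟨?_, hi1.trans (mul_le_mul_of_nonneg_left hi.2 hC₁.le)⟩
      rw [div_le_iff₀ hC₂, mul_comm]
      exact hi.1.trans hi2
  choose c hc C hcC using hbd
  -- By compactness of the intervals, one ultrafilter gives limits at all vertices simultaneously.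
  let U : Ultrafilter (Finset V × ℕ) := Ultrafilter.of atTop
  have hU : (U : Filter (Finset V × ℕ)) ≤ atTop := Ultrafilter.of_le _
  have hlim : ∀ x, ∃ w ∈ Set.Icc (c x) (C x), Tendsto (fun i => v i x) U (𝓝 w) := by
    intro x
    have h1 : ((U.map fun i => v i x : Ultrafilter ℝ) : Filter ℝ) ≤ 𝓟 (Set.Icc (c x) (C x)) := by
      rw [le_principal_iff]
      exact hU (hcC x)
    exact isCompact_Icc.ultrafilter_le_nhds _ h1
  choose W hWmem hW using hlim
  refine ⟨W, fun x => (hc x).trans_le (hWmem x).1, fun x => ?_⟩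
  have h1 : Tendsto (fun i => G.algLaplacian (v i) x) U (𝓝 (G.algLaplacian W x)) := by
    simp only [algLaplacian_eq_sum, smul_eq_mul]
    exact (tendsto_finsetSum _ fun y _ => ((hW x).sub (hW y)).const_mul _).const_mul _
  have h2 : Tendsto (fun i : Finset V × ℕ => 1 / ((i.2 : ℝ) + 1)) U (𝓝 0) := by
    have h3 : Tendsto (fun i : Finset V × ℕ => i.2) atTop atTop := by
      rw [← prod_atTop_atTop_eq]
      exact tendsto_snd
    exact (tendsto_one_div_add_atTop_nhds_zero_nat.comp h3).mono_left hU
  have h4 := (h2.const_sub (q x)).mul (hW x)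
  rw [sub_zero] at h4
  exact le_of_tendsto_of_tendsto h4 h1 (hU (hvsup x))

end WeightedGraph

end

noncomputable section

/-! ### From spectral information to potentials dominated by the form. -/

namespace WeightedGraph

variable {V : Type*} (G : WeightedGraph V)

theorem eq_of_energy_eq_zero {f : V → ℂ} (h : G.energy f = 0) {x y : V}
    (hxy : Relation.ReflTransGen (fun a b => 0 < G.E a b) x y) : f x = f y := by
  induction hxy with
  | refl => rfl
  | tail _ hyz ih => exact ih.trans (G.energy_eq_zero_imp h hyz)

theorem algLaplacian_one (x : V) : G.algLaplacian (fun _ => (1 : ℝ)) x = 0 := by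
  simp [algLaplacian]

section ell2

variable [MeasurableSpace V] [DiscreteMeasurableSpace V]

/-- Bridge from Hilbert space norms to pointwise potentials: the squared norm of the restriction to
`s` weights the potential by the indicator of `s`. -/
theorem formGE_of_finSupp {a b : ℝ} {s : Set V}
    (h : ∀ F : G.finSupp, a * ‖(F : G.ell2)‖ ^ 2 + b * ‖G.cutoff s F‖ ^ 2
      ≤ (inner ℂ (F : G.ell2) (G.minLaplacian F)).re) :
    G.FormGE fun x => a + s.indicator (fun _ => b) x := by
  intro K f hf
  have hs : (Function.support fun x => (f x : ℂ)).Finite := by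
    refine K.finite_toSet.subset fun x hx => ?_
    by_contra hxK
    exact hx (by simp [hf x hxK])
  set F := G.mkFinSupp _ hs with hF
  have hcoe : ⇑(F : G.ell2) = fun x => (f x : ℂ) := G.coe_mkFinSupp _ hs
  have hlap : ∀ x, G.algLaplacian (fun x => (f x : ℂ)) x = ((G.algLaplacian f x : ℝ) : ℂ) := by
    intro x
    simp only [algLaplacian_eq_sum, Complex.real_smul, smul_eq_mul]
    push_cast
    rfl
  have h1 : ‖(F : G.ell2)‖ ^ 2 = ∑ x ∈ K, G.m x * f x ^ 2 := by
    have h2 := G.hasSum_norm_sq (F : G.ell2)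
    rw [hcoe] at h2
    simp only [Complex.norm_real, Real.norm_eq_abs, sq_abs] at h2
    exact h2.unique (hasSum_sum_of_ne_finset_zero fun x hx => by simp [hf x hx])
  have h2 : ‖G.cutoff s F‖ ^ 2 = ∑ x ∈ K, G.m x * (s.indicator (fun _ => 1) x * f x ^ 2) := by
    have h3 := G.hasSum_norm_sq (G.cutoff s F)
    rw [coe_cutoff, hcoe] at h3
    have h4 : ∀ x, ‖s.indicator (fun x => (f x : ℂ)) x‖ ^ 2
        = s.indicator (fun _ => 1) x * f x ^ 2 := fun x => by
      by_cases hx : x ∈ s <;> simp [hx]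
    simp only [h4] at h3
    exact h3.unique (hasSum_sum_of_ne_finset_zero fun x hx => by simp [hf x hx])
  have h3 : (inner ℂ (F : G.ell2) (G.minLaplacian F)).re
      = ∑ x ∈ K, G.m x * (f x * G.algLaplacian f x) := by
    have h4 := Complex.hasSum_re (G.hasSum_inner (F : G.ell2) (G.minLaplacian F))
    rw [coe_minLaplacian, hcoe] at h4
    have h5 : ∀ x, ((G.m x : ℂ) * inner ℂ (f x : ℂ)
        (G.algLaplacian (fun x => (f x : ℂ)) x)).re = G.m x * (f x * G.algLaplacian f x) := by
      intro x
      rw [hlap, Complex.re_ofReal_mul, RCLike.inner_apply, Complex.conj_ofReal,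
        ← Complex.ofReal_mul, Complex.ofReal_re, mul_comm (f x)]
    simp only [h5] at h4
    exact h4.unique (hasSum_sum_of_ne_finset_zero fun x hx => by simp [hf x hx])
  have h4 := h F
  rw [h1, h2, h3, Finset.mul_sum, Finset.mul_sum, ← Finset.sum_add_distrib] at h4
  refine le_trans (Finset.sum_le_sum fun x _ => le_of_eq ?_) h4
  by_cases hx : x ∈ s <;> simp [hx] <;> ring

/-- A positive supersolution up to the bottom of the spectrum. -/
theorem exists_supersolution_of_le_specBottom {l : ℝ} (hl : (l : EReal) ≤ G.specBottom) :
    ∃ W : V → ℝ, (∀ x, 0 < W x) ∧ ∀ x, l * W x ≤ G.algLaplacian W x := by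
  rcases le_or_gt l 0 with hl0 | hl0
  · exact ⟨fun _ => 1, fun _ => one_pos, fun x => by rw [G.algLaplacian_one]; linarith⟩
  have hq : G.FormGE fun x => l + (∅ : Set V).indicator (fun _ => 0) x := by
    refine G.formGE_of_finSupp fun F => ?_
    obtain ⟨h, he⟩ := G.mem_domain_of_finSupp F
    have := UnboundedOp.form_ge_of_le_bottom_spec G.laplacian_isNonneg hl0 hl ⟨F, h⟩
    rw [he] at this
    simpa using this
  simpa using hq.exists_supersolution

/-- Below the essential spectrum, the form is controlled by a finite rank projection. -/
theorem exists_projection {l : ℝ} (hl0 : 0 < l) (hl : (l : EReal) < G.essSpecBottom) :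
    ∃ P : G.ell2 →L[ℂ] G.ell2, FiniteDimensional ℂ (LinearMap.range (P : G.ell2 →ₗ[ℂ] G.ell2)) ∧
      (∀ f, inner ℂ (P f) f = (‖P f‖ : ℂ) ^ 2) ∧
      ∃ δ : ℝ, 0 ≤ δ ∧ ((∀ f : G.ell2, G.energy f = 0 → f = 0) → 0 < δ) ∧
        ∀ F : G.finSupp, l * ‖(F : G.ell2) - P F‖ ^ 2 + δ * ‖P F‖ ^ 2
          ≤ (inner ℂ (F : G.ell2) (G.minLaplacian F)).re := by
  obtain ⟨P, hfin, hsa, hPP, δ, hδ0, -, hδ, h⟩ :=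
    UnboundedOp.exists_projection_of_lt_bottom_essSpec G.laplacian_isNonneg hl0 hl
  have hP : ∀ f, inner ℂ (P f) f = (‖P f‖ : ℂ) ^ 2 := by
    intro f
    have hsym := ContinuousLinearMap.isSelfAdjoint_iff_isSymmetric.mp hsa (P f) f
    simp only [ContinuousLinearMap.coe_coe] at hsym
    rw [← mul_apply_eq_comp, hPP] at hsym
    rw [hsym, inner_self_eq_norm_sq_to_K]
    rfl
  refine ⟨P, hfin, hP, δ, hδ0, fun h0 => hδ (G.eigenspace_zero_eq_bot h0), fun F => ?_⟩
  obtain ⟨hd, he⟩ := G.mem_domain_of_finSupp F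
  have h1 := h ⟨F, hd⟩
  rw [he] at h1
  have h2 : ‖(F : G.ell2) - P F‖ ^ 2 = ‖(F : G.ell2)‖ ^ 2 - ‖P F‖ ^ 2 := by
    have h3 := @norm_sub_sq ℂ _ _ _ _ (F : G.ell2) (P F)
    have h4 : RCLike.re (inner ℂ (F : G.ell2) (P F)) = ‖P F‖ ^ 2 := by
      rw [inner_re_symm, hP]
      change (((‖P (F : G.ell2)‖ : ℝ) : ℂ) ^ 2).re = _
      rw [← Complex.ofReal_pow, Complex.ofReal_re]
    rw [h3, h4]
    ring
  rw [h2]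
  simp only at h1
  linarith

/-- Below the essential spectrum the form dominates a positive constant outside of a large ball, up to
a bounded error on the ball. -/
theorem exists_formGE_of_lt_essSpecBottom {S : ℕ → Finset V} (hS : G.IsDecomposition S)
    {l l' : ℝ} (hl0 : 0 < l) (hll' : l < l') (hl' : (l' : EReal) < G.essSpecBottom) :
    ∃ N, 1 ≤ N ∧ G.FormGE fun x => l + (ball S N).indicator (fun _ => -(2 * l')) x := by
  obtain ⟨P, hfin, hP, δ, hδ0, -, h⟩ := G.exists_projection (hl0.trans hll') hl'
  have hl'0 := hl0.trans hll'
  -- Chosen so that `2 l' η² = l' - l`: the tail of `P F` costs exactly the gap between `l'` and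
  -- `l`.
  set η : ℝ := √((l' - l) / (2 * l')) with hη
  have hηsq : η ^ 2 = (l' - l) / (2 * l') := Real.sq_sqrt (by
    have := sub_pos.mpr hll'
    positivity)
  have hηpos : 0 < η := Real.sqrt_pos.mpr (by
    have := sub_pos.mpr hll'
    positivity)
  obtain ⟨N, hN1, hN⟩ := hS.exists_norm_cutoff_le (LinearMap.range (P : G.ell2 →ₗ[ℂ] G.ell2)) hηpos
  refine ⟨N, hN1, G.formGE_of_finSupp fun F => ?_⟩
  have h1 := h F
  set u := P (F : G.ell2) with hu
  -- Since `‖u‖² = ⟨u, F⟩`, split at the ball: inside, the restriction falls on `F`; outside, on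
  -- `u`, where it is small.
  have hu2 : ‖u‖ ^ 2 ≤ ‖u‖ * ‖G.cutoff (ball S N) F‖ + η * ‖u‖ * ‖(F : G.ell2)‖ := by
    have h2 : inner ℂ u (F : G.ell2) = inner ℂ u (G.cutoff (ball S N) F)
        + inner ℂ (G.cutoff (ball S N)ᶜ u) (F : G.ell2) := by
      rw [inner_cutoff_left, ← inner_add_right, cutoff_add_cutoff_compl]
    have h3 : ‖u‖ ^ 2 = ‖inner ℂ u (F : G.ell2)‖ := by
      rw [hu, hP, norm_pow, Complex.norm_real, norm_norm]
    rw [h3, h2]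
    refine (norm_add_le _ _).trans (add_le_add (norm_inner_le_norm _ _) ?_)
    refine (norm_inner_le_norm _ _).trans ?_
    exact mul_le_mul_of_nonneg_right (hN u ⟨F, rfl⟩) (norm_nonneg _)
  have hu1 : ‖u‖ ≤ ‖G.cutoff (ball S N) F‖ + η * ‖(F : G.ell2)‖ := by
    rcases (norm_nonneg u).eq_or_lt with h0 | h0
    · rw [← h0]; positivity
    · refine le_of_mul_le_mul_left ?_ h0
      linarith
  have hu3 : ‖u‖ ^ 2 ≤ 2 * ‖G.cutoff (ball S N) F‖ ^ 2 + 2 * η ^ 2 * ‖(F : G.ell2)‖ ^ 2 := by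
    have h4 := pow_le_pow_left₀ (norm_nonneg u) hu1 2
    nlinarith [sq_nonneg (‖G.cutoff (ball S N) F‖ - η * ‖(F : G.ell2)‖)]
  have hv : ‖(F : G.ell2)‖ ^ 2 - ‖u‖ ^ 2 = ‖(F : G.ell2) - u‖ ^ 2 := by
    have h3 := @norm_sub_sq ℂ _ _ _ _ (F : G.ell2) u
    have h4 : RCLike.re (inner ℂ (F : G.ell2) u) = ‖u‖ ^ 2 := by
      rw [inner_re_symm, hu, hP]
      change (((‖P (F : G.ell2)‖ : ℝ) : ℂ) ^ 2).re = _
      rw [← Complex.ofReal_pow, Complex.ofReal_re]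
    rw [h3, h4]
    ring
  have h5 : l' * ‖u‖ ^ 2 ≤ 2 * l' * ‖G.cutoff (ball S N) F‖ ^ 2
      + (l' - l) * ‖(F : G.ell2)‖ ^ 2 := by
    have h6 := mul_le_mul_of_nonneg_left hu3 hl'0.le
    have h7 : l' * (2 * η ^ 2) = l' - l := by
      rw [hηsq]
      field_simp
    calc l' * ‖u‖ ^ 2 ≤ _ := h6
      _ = 2 * l' * ‖G.cutoff (ball S N) F‖ ^ 2 + l' * (2 * η ^ 2) * ‖(F : G.ell2)‖ ^ 2 := by ring
      _ = _ := by rw [h7]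
  have h8 : 0 ≤ δ * ‖u‖ ^ 2 := by positivity
  rw [← hv] at h1
  linarith

/-- If no non-zero function has zero energy, the form is non-negative and dominates a positive
constant outside of a large ball. -/
theorem exists_formGE_compl_of_lt_essSpecBottom {S : ℕ → Finset V} (hS : G.IsDecomposition S)
    (h0 : ∀ f : G.ell2, G.energy f = 0 → f = 0)
    {l l' : ℝ} (hl0 : 0 < l) (hll' : l < l') (hl' : (l' : EReal) < G.essSpecBottom) :
    ∃ N, 1 ≤ N ∧ G.FormGE fun x => 0 + (ball S N)ᶜ.indicator (fun _ => l) x := by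
  obtain ⟨P, hfin, -, δ, -, hδ, h⟩ := G.exists_projection (hl0.trans hll') hl'
  have hl'0 := hl0.trans hll'
  have hδ0 := hδ h0
  have hgap : 0 < 1 / l - 1 / l' := sub_pos.mpr (one_div_lt_one_div_of_lt hl0 hll')
  -- Chosen so that `1 / l' + η² / δ = 1 / l`; weighted Cauchy–Schwarz then gives `l (‖v‖ + η ‖u‖)²
  -- ≤ l' ‖v‖² + δ ‖u‖²`.
  set η : ℝ := √(δ * (1 / l - 1 / l')) with hη
  have hηsq : η ^ 2 = δ * (1 / l - 1 / l') := Real.sq_sqrt (by positivity)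
  have hηpos : 0 < η := Real.sqrt_pos.mpr (by positivity)
  obtain ⟨N, hN1, hN⟩ := hS.exists_norm_cutoff_le (LinearMap.range (P : G.ell2 →ₗ[ℂ] G.ell2)) hηpos
  refine ⟨N, hN1, G.formGE_of_finSupp fun F => ?_⟩
  refine le_trans ?_ (h F)
  set u := P (F : G.ell2) with hu
  set v := (F : G.ell2) - u with hv
  have h1 : ‖G.cutoff (ball S N)ᶜ F‖ ≤ ‖v‖ + η * ‖u‖ := by
    have h2 : G.cutoff (ball S N)ᶜ F = G.cutoff (ball S N)ᶜ v + G.cutoff (ball S N)ᶜ u := by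
      rw [← cutoff_add, hv, sub_add_cancel]
    rw [h2]
    exact (norm_add_le _ _).trans (add_le_add (G.norm_cutoff_le _ _) (hN u ⟨F, rfl⟩))
  have h2 := pow_le_pow_left₀ (norm_nonneg _) h1 2
  have h3 : l * (‖v‖ + η * ‖u‖) ^ 2 ≤ l' * ‖v‖ ^ 2 + δ * ‖u‖ ^ 2 := by
    have h4 : (l' - l) * (δ * ‖u‖ ^ 2) = l * l' * (η * ‖u‖) ^ 2 := by
      rw [mul_pow, hηsq]
      field_simp
    have h5 : 0 ≤ ((l' - l) * ‖v‖ - l * (η * ‖u‖)) ^ 2 := sq_nonneg _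
    have h6 : 0 < l' - l := sub_pos.mpr hll'
    refine le_of_mul_le_mul_left ?_ h6
    nlinarith
  have h4 := mul_le_mul_of_nonneg_left h2 hl0.le
  linarith

/-! ### Supersolutions below the essential spectrum, and exclusion of zero modes. -/

theorem add_half_lt_of_le_sub {l ε : ℝ} {b : EReal} (hε : 0 < ε)
    (h : (l : EReal) ≤ b - (ε : EReal)) : ((l + ε / 2 : ℝ) : EReal) < b := by
  induction b with
  | bot => simp at h
  | coe b =>
    have h1 : l ≤ b - ε := by exact_mod_cast h
    exact_mod_cast (show l + ε / 2 < b by linarith)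
  | top => exact EReal.coe_lt_top _

theorem IsDecomposition.exists_supersolution_sub {G : WeightedGraph V} {S : ℕ → Finset V}
    (hS : G.IsDecomposition S) {ε l : ℝ} (hε : 0 < ε)
    (hl : (l : EReal) ≤ G.essSpecBottom - (ε : EReal)) :
    ∃ N : ℕ, 1 ≤ N ∧ ∃ C : ℝ, 0 < C ∧ ∃ W : V → ℝ, (∀ x, 0 < W x) ∧
      ∀ x, l * W x - C * (ball S N).indicator 1 x ≤ G.algLaplacian W x := by
  rcases le_or_gt l 0 with hl0 | hl0
  · refine ⟨1, le_rfl, 1, one_pos, fun _ => 1, fun _ => one_pos, fun x => ?_⟩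
    rw [G.algLaplacian_one]
    have : (0 : ℝ) ≤ (ball S 1).indicator 1 x := Set.indicator_nonneg (fun _ _ => zero_le_one) x
    linarith
  obtain ⟨N, hN, hq⟩ := G.exists_formGE_of_lt_essSpecBottom hS hl0 (l' := l + ε / 2)
    (by linarith) (add_half_lt_of_le_sub hε hl)
  obtain ⟨W, hW, hWL⟩ := hq.exists_supersolution
  have hfin : (ball S N).Finite := by
    have : ball S N = ⋃ i ∈ Set.Iic N, (S i : Set V) := by
      ext x
      simp [ball]
    rw [this]
    exact (Set.finite_Iic N).biUnion fun i _ => (S i).finite_toSet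
  obtain ⟨M, hM⟩ := (hfin.image W).bddAbove
  -- The potential is `l - 2 l' 1_B` with `l' = l + ε / 2`, so `C` must dominate `2 l' W` on the
  -- ball; the maximum with `1` makes `C` positive.
  refine ⟨N, hN, 2 * (l + ε / 2) * max M 1, by positivity, W, hW, fun x => ?_⟩
  refine le_trans ?_ (hWL x)
  by_cases hx : x ∈ ball S N
  · have h1 : W x ≤ max M 1 := (hM ⟨x, hx, rfl⟩).trans (le_max_left _ _)
    have h2 : 2 * (l + ε / 2) * W x ≤ 2 * (l + ε / 2) * max M 1 :=
      mul_le_mul_of_nonneg_left h1 (by positivity)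
    simp only [hx, Set.indicator_of_mem, Pi.one_apply]
    linarith
  · simp [hx]

theorem IsDecomposition.exists_supersolution_compl {G : WeightedGraph V} {S : ℕ → Finset V}
    (hS : G.IsDecomposition S) (h0 : ∀ f : G.ell2, G.energy f = 0 → f = 0) {ε l : ℝ} (hε : 0 < ε)
    (hl : (l : EReal) ≤ G.essSpecBottom - (ε : EReal)) :
    ∃ N : ℕ, 1 ≤ N ∧ ∃ W : V → ℝ, (∀ x, 0 < W x) ∧
      ∀ x, l * (ball S N)ᶜ.indicator 1 x * W x ≤ G.algLaplacian W x := by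
  rcases le_or_gt l 0 with hl0 | hl0
  · refine ⟨1, le_rfl, fun _ => 1, fun _ => one_pos, fun x => ?_⟩
    rw [G.algLaplacian_one, mul_one]
    exact mul_nonpos_of_nonpos_of_nonneg hl0 (Set.indicator_nonneg (fun _ _ => zero_le_one) x)
  obtain ⟨N, hN, hq⟩ := G.exists_formGE_compl_of_lt_essSpecBottom hS h0 hl0 (l' := l + ε / 2)
    (by linarith) (add_half_lt_of_le_sub hε hl)
  obtain ⟨W, hW, hWL⟩ := hq.exists_supersolution
  refine ⟨N, hN, W, hW, fun x => le_trans (le_of_eq ?_) (hWL x)⟩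
  by_cases hx : x ∈ (ball S N)ᶜ
  · simp only [hx, Set.indicator_of_mem, Pi.one_apply, mul_one, zero_add]
  · simp only [hx, not_false_eq_true, Set.indicator_of_notMem, mul_zero, zero_add]

/-- Zero energy makes `f` constant on the infinite component of each vertex; with masses bounded
below, a non-zero constant there would not be square summable. -/
theorem eq_zero_of_energy_eq_zero_of_iInf_pos (hm : 0 < ⨅ x, G.m x) {f : G.ell2}
    (hf : G.energy f = 0) : f = 0 := by
  refine G.ell2_ext fun x => ?_
  rw [coe_zero, Pi.zero_apply]
  by_contra hx
  set s := {y | Relation.ReflTransGen (fun a b => 0 < G.E a b) x y} with hs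
  have hinf : Infinite s := (G.infinite_component x).to_subtype
  have h1 : Summable fun y : s => G.m y * ‖f y‖ ^ 2 := (G.hasSum_norm_sq f).summable.subtype s
  have h2 : Summable fun _ : s => (⨅ x, G.m x) * ‖f x‖ ^ 2 := by
    refine Summable.of_nonneg_of_le (fun _ => by positivity) (fun y => ?_) h1
    rw [← G.eq_of_energy_eq_zero hf y.2]
    exact mul_le_mul_of_nonneg_right
      (ciInf_le ⟨0, by rintro _ ⟨z, rfl⟩; exact (G.m_pos z).le⟩ _) (by positivity)
  have h3 := (summable_const_iff _).mp h2
  have h4 : 0 < (⨅ x, G.m x) * ‖f x‖ ^ 2 := by positivity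
  exact h4.ne' h3

end ell2

/-- Without this edge the component of `n` would be trapped in `{0, …, n}` and hence finite. -/
theorem nat_edge_succ (G : WeightedGraph ℕ) (hE : ∀ n k : ℕ, 0 < G.E n k → n ≤ k + 1 ∧ k ≤ n + 1)
    (n : ℕ) : 0 < G.E n (n + 1) := by
  by_contra h
  refine G.infinite_component n ((Set.finite_Iic n).subset fun y hy => ?_)
  induction hy with
  | refl => exact Set.mem_Iic.mpr le_rfl
  | @tail a b _ hab ih =>
    have ha : a ≤ n := ih
    rcases ha.eq_or_lt with rfl | ha'
    · refine Set.mem_Iic.mpr (not_lt.mp fun hb => h ?_)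
      have : b = a + 1 := by have := (hE a b hab).2; omega
      rwa [← this]
    · have := (hE a b hab).2
      exact Set.mem_Iic.mpr (by omega)

theorem nat_eq_zero_of_energy_eq_zero (G : WeightedGraph ℕ)
    (hE : ∀ n k : ℕ, 0 < G.E n k → n ≤ k + 1 ∧ k ≤ n + 1) (hm : G.measure Set.univ = ⊤)
    {f : G.ell2} (hf : G.energy f = 0) : f = 0 := by
  have hconst : ∀ n, f n = f 0 := fun n => by
    induction n with
    | zero => rfl
    | succ n ih => rw [← ih, G.energy_eq_zero_imp hf (G.nat_edge_succ hE n)]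
  have h0 : f 0 = 0 := by
    by_contra h0
    have h1 := (G.hasSum_norm_sq f).summable
    simp only [hconst] at h1
    have h2 : Summable G.m := (summable_mul_right_iff (by positivity)).mp h1
    rw [measure, Measure.sum_apply _ MeasurableSet.univ] at hm
    simp only [Measure.smul_apply, measure_univ, smul_eq_mul, mul_one] at hm
    exact h2.tsum_ofReal_ne_top hm
  exact G.ell2_ext fun n => by rw [hconst, h0, coe_zero, Pi.zero_apply]

end WeightedGraph

end

/-- Quantifying over real `l ≤ λ⁰_ess - ε` in the extended reals covers both cases: for `λ⁰_ess =
+∞` the difference is `+∞` and `l` is arbitrary. -/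
theorem mainTheorem2 {V : Type*} [Countable V] [MeasurableSpace V] [DiscreteMeasurableSpace V]
    (G : WeightedGraph V) :
    -- a)
    (∀ l : ℝ, (l : EReal) ≤ G.specBottom →
      ∃ W : V → ℝ, (∀ x, 0 < W x) ∧ ∀ x, l * W x ≤ G.algLaplacian W x) ∧
    (∀ S : ℕ → Finset V, G.IsDecomposition S →
      -- b)
      (∀ ε : ℝ, 0 < ε → ∀ l : ℝ, (l : EReal) ≤ G.essSpecBottom - (ε : EReal) →
        ∃ N : ℕ, 1 ≤ N ∧ ∃ C : ℝ, 0 < C ∧ ∃ W : V → ℝ, (∀ x, 0 < W x) ∧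
          ∀ x, l * W x - C * (WeightedGraph.ball S N).indicator 1 x ≤ G.algLaplacian W x) ∧
      -- c)
      (0 < ⨅ x, G.m x →
        ∀ ε : ℝ, 0 < ε → ∀ l : ℝ, (l : EReal) ≤ G.essSpecBottom - (ε : EReal) →
          ∃ N : ℕ, 1 ≤ N ∧ ∃ W : V → ℝ, (∀ x, 0 < W x) ∧
            ∀ x, l * (WeightedGraph.ball S N)ᶜ.indicator 1 x * W x ≤ G.algLaplacian W x)) ∧
    -- d)
    (∀ G' : WeightedGraph ℕ, (∀ n k : ℕ, 0 < G'.E n k → n ≤ k + 1 ∧ k ≤ n + 1) →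
      G'.measure Set.univ = ⊤ →
      ∀ S : ℕ → Finset ℕ, G'.IsDecomposition S →
        ∀ ε : ℝ, 0 < ε → ∀ l : ℝ, (l : EReal) ≤ G'.essSpecBottom - (ε : EReal) →
          ∃ N : ℕ, 1 ≤ N ∧ ∃ W : ℕ → ℝ, (∀ x, 0 < W x) ∧
            ∀ x, l * (WeightedGraph.ball S N)ᶜ.indicator 1 x * W x ≤ G'.algLaplacian W x) := by
  exact ⟨fun l hl => G.exists_supersolution_of_le_specBottom hl,
    fun S hS => ⟨fun ε hε l hl => hS.exists_supersolution_sub hε hl,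
      fun hm ε hε l hl => hS.exists_supersolution_compl
        (fun f hf => G.eq_zero_of_energy_eq_zero_of_iInf_pos hm hf) hε hl⟩,
    fun G' hE hm S hS ε hε l hl => hS.exists_supersolution_compl
      (fun f hf => G'.nat_eq_zero_of_energy_eq_zero hE hm hf) hε hl⟩
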